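/- Let $e\ge 4$ and let $a_2,\dots,a_{e-1}\ge 2$ be integers (the data of a cyclic quotient singularity of embedding dimension $e$). **Triangles.** A *coloured triangle* $\triangle_{\delta,\varepsilon}$ ($\delta<\varepsilon$) is a set of black dots among the dots $(\alpha,\beta)$ with $\delta\le\alpha$, $\alpha+2\le\beta\le\varepsilon$; its height is $\varepsilon-\delta-1$. It is *sparse* if for it and for each sub-triangle $\triangle_{\alpha,\beta}$ with $\delta\le\alpha$, $\alpha+2\le\beta\le\varepsilon$ the number of black dots is at most the height $\beta-\alpha-1$, with equality if and only if the vertex $(\alpha,\beta)$ is black (a triangle of height $0$ has no dots and is sparse). The *extended triangle* has in addition the black dots $(\alpha,\alpha+1)$, $\delta\le\alpha<\varepsilon$. For $\delta\le\beta\le\varepsilon$ let $R_\beta$ (resp. $L_\beta$) be the number of black dots $(\beta,\gamma)$ (resp. $(\gamma,\beta)$) of the extended triangle. The weight of a black dot is $w_{\alpha,\beta}=1+\sum w_{\alpha',\beta'}$, the sum over the black dots with $\alpha'<\alpha$, $\beta'>\beta$; put $\alpha_\beta=1+\sum_{\alpha<\beta<\gamma}w_{\alpha,\gamma}$ (sum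 over black dots), and $k_\beta=R_\beta+L_\beta$ if $\alpha_\beta=1$, $k_\beta=R_\beta+L_\beta-1$ otherwise. The blow-up $\operatorname{Bl}_\varepsilon(\triangle_{2,e-2})$ is the triangle $\triangle_{2,e-1}$ whose black dots are the $(s(\beta),s(\gamma))$ with $s(\gamma)\ge s(\beta)+2$ and $(\beta,\gamma)$ black in the extended triangle of $\triangle_{2,e-2}$, where $s(\beta)=\beta$ for $\beta<\varepsilon$ and $s(\beta)=\beta+1$ for $\beta\ge\varepsilon$. **Ring.** Let $A$ be the polynomial ring over $\mathbb C$ in $t_\varepsilon$ ($2<\varepsilon<e-1$) and $s_\varepsilon^{(\nu)}$ ($2\le\varepsilon\le e-1$, $1\le\nu\le a_\varepsilon-1$); put $t_2=t_{e-1}=0$, $s_\varepsilon^{(0)}=1$, $l_\varepsilon=0$, $r_\varepsilon=-t_\varepsilon$. Starting from $$Z_\varepsilon^{(00)}=(z+t_\varepsilon)\sum_{\nu=0}^{a_\varepsilon-1}s_\varepsilon^{(\nu)}z^{a_\varepsilon-1-\nu}\in A[z],$$ define $Z_\varepsilon^{(ij)}\in A[z]$ and $\sigma_\varepsilon^{(ij)}\in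 A$ by successive division with remainder: $Z_\varepsilon^{(ij)}=(z-l_\varepsilon)Z_\varepsilon^{(i+1,j)}+\sigma_\varepsilon^{(i+1,j)}=(z-r_\varepsilon)Z_\varepsilon^{(i,j+1)}+\sigma_\varepsilon^{(i,j+1)}$. **The ideal.** For a sparse coloured triangle $\triangle_{\delta,\varepsilon}$ put $\theta_\beta=1$ if $\alpha_\beta=1$ and $\theta_\beta=0$ if $\alpha_\beta>1$, and $$\lambda(\triangle_{\delta,\varepsilon})=\prod_{\beta=\delta}^{\varepsilon}\sigma_\beta^{(R_\beta+\theta_\beta,\,L_\beta)},\qquad \rho(\triangle_{\delta,\varepsilon})=\prod_{\beta=\delta}^{\varepsilon}\sigma_\beta^{(R_\beta,\,L_\beta+\theta_\beta)}.$$ Let $J'\subset A$ be the ideal generated by all $(l_\varepsilon-r_\varepsilon)\sigma_\varepsilon^{(11)}$, $2<\varepsilon<e-1$, all $\lambda(\triangle_{\delta,\varepsilon})$ with $2\le\delta<\varepsilon<e-1$, and all $\rho(\triangle_{\delta,\varepsilon})$ with $2<\delta<\varepsilon\le e-1$, where $\triangle_{\delta,\varepsilon}$ runs through the sparse coloured triangles.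 **Proposition.** Assume that the $a_\varepsilon$ are large enough: $a_\varepsilon\ge k_\varepsilon(\triangle)$ for all $2\le\varepsilon\le e-1$ and all sparse coloured triangles $\triangle=\triangle_{2,e-1}$. Then $J'$ has exactly $C_{e-3}=\frac1{e-2}\binom{2(e-3)}{e-3}$ reduced (irreducible) components, i.e. minimal primes. More precisely: 1. The map sending a sparse coloured triangle $\triangle=\triangle_{2,e-1}$ to the ideal $P_\triangle$, generated by the $t_\varepsilon$ with $\alpha_\varepsilon>1$ and the $\sigma_\varepsilon^{(ij)}$ with $2\le\varepsilon\le e-1$, $i\le R_\varepsilon$, $j\le L_\varepsilon$, $1\le i+j\le k_\varepsilon$, is a bijection onto the set of minimal primes of $J'$. 2. The empty triangle gives the Artin component: $P_\emptyset=(\sigma_\varepsilon^{(11)}:2<\varepsilon<e-1)$, and this ideal is a minimal prime of $J'$. 3. For each $2<\varepsilon<e-1$ the blow-up at $\varepsilon$ of each sparse $\triangle_{2,e-2}$ is a sparse $\triangle_{2,e-1}$, and the components on which $\sigma_\varepsilon^{(11)}$ does not vanish identically are exactly those of the blow-ups at $\varepsilon$: the minimal primes of $J'$ not containing $\sigma_\varepsilon^{(11)}$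 are the $P_{\operatorname{Bl}_\varepsilon(\triangle')}$, with $\triangle'=\triangle_{2,e-2}$ sparse. 4. Every minimal prime of $J'$ other than that of the Artin component is of the form $P_{\operatorname{Bl}_\varepsilon(\triangle')}$ with $2<\varepsilon<e-1$ and $\triangle'=\triangle_{2,e-2}$ sparse. -/

import Mathlib

open Polynomial

namespace CyclicQuotient

/-! ## Coloured triangles

A dot is a pair `(α, β)` of natural numbers. The triangle with vertex `(δ, ε)` consists of the dots
`(α, β)` with `δ ≤ α`, `α + 2 ≤ β` and `β ≤ ε`; the extended triangle has in addition the base line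
of dots `(α, α + 1)`, `δ ≤ α < ε`, which is always black. A colouring is given by the finite set
`B` of black dots of the (non-extended) triangle. -/

/-- `B` is a set of dots of the triangle with vertex `(δ, ε)`. -/
def IsColouring (δ ε : ℕ) (B : Finset (ℕ × ℕ)) : Prop :=
  ∀ p ∈ B, δ ≤ p.1 ∧ p.1 + 2 ≤ p.2 ∧ p.2 ≤ ε

/-- The number of black dots in the sub-triangle with vertex `(α, β)`. -/
def blackCount (B : Finset (ℕ × ℕ)) (α β : ℕ) : ℕ :=
  (B.filter fun p => α ≤ p.1 ∧ p.2 ≤ β).card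

/-- `B` is a sparse coloured triangle with vertex `(δ, ε)`: for the triangle and for each
sub-triangle with vertex `(α, β)`, of height `β - α - 1`, the number of black dots is at most the
height, with equality if and only if the vertex is black. -/
def IsSparse (δ ε : ℕ) (B : Finset (ℕ × ℕ)) : Prop :=
  IsColouring δ ε B ∧
    ∀ α β : ℕ, δ ≤ α → α + 2 ≤ β → β ≤ ε →
      blackCount B α β ≤ β - α - 1 ∧ (blackCount B α β = β - α - 1 ↔ (α, β) ∈ B)

/-- The black dots of the extended triangle. -/
def extended (δ ε : ℕ) (B : Finset (ℕ × ℕ)) : Finset (ℕ × ℕ) :=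
  B ∪ (Finset.Ico δ ε).image fun α => (α, α + 1)

/-- The number of black dots `(β, γ)` on the right half-line of `l_β` in the extended triangle. -/
def rightCount (δ ε : ℕ) (B : Finset (ℕ × ℕ)) (β : ℕ) : ℕ :=
  ((extended δ ε B).filter fun p => p.1 = β).card

/-- The number of black dots `(α, β)` on the left half-line of `l_β` in the extended triangle. -/
def leftCount (δ ε : ℕ) (B : Finset (ℕ × ℕ)) (β : ℕ) : ℕ :=
  ((extended δ ε B).filter fun p => p.2 = β).card

/-- The weight of the dot `(δ, ε)`: one plus the sum of the weights of the black dots `(α, β)` in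
the sector above it, i.e. with `α < δ` and `β > ε`. -/
def weight (B : Finset (ℕ × ℕ)) (δ ε : ℕ) : ℕ :=
  1 + ∑ p ∈ (B.filter fun p => p.1 < δ ∧ ε < p.2).attach, weight B p.1.1 p.1.2
termination_by δ
decreasing_by exact (Finset.mem_filter.mp p.2).2.1

/-- The number `α_β`: one plus the sum of the weights of the black dots above the line `l_β`. -/
def alphaNum (B : Finset (ℕ × ℕ)) (β : ℕ) : ℕ :=
  1 + ∑ p ∈ B.filter (fun p => p.1 < β ∧ β < p.2), weight B p.1 p.2

/-- The number `k_β`: the number of black dots on the line `l_β` in the extended triangle if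
`α_β = 1`, and this number minus one otherwise. -/
def kNum (δ ε : ℕ) (B : Finset (ℕ × ℕ)) (β : ℕ) : ℕ :=
  ((extended δ ε B).filter fun p => p.1 = β ∨ p.2 = β).card -
    if alphaNum B β = 1 then 0 else 1

/-- The shift function `s` which leaves the index `ε` free. -/
def shift (ε β : ℕ) : ℕ := if β < ε then β else β + 1

/-- The blow-up at `ε` of the coloured triangle `B` with vertex `(δ, η)`; it is a coloured triangle
with vertex `(δ, η + 1)`. One shifts the black dots of the extended triangle and deletes the base
line of the result (on the line `l_ε` only dots of the base line are black). -/
def blowUp (δ η ε : ℕ) (B : Finset (ℕ × ℕ)) : Finset (ℕ × ℕ) :=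
  ((extended δ η B).image fun p => (shift ε p.1, shift ε p.2)).filter fun p => p.1 + 2 ≤ p.2

/-! ## The coordinate ring of the deformation space

The equations `z_{ε-1} z_{ε+1} = z_ε ^ a_ε` are deformed to
`z_{ε-1} (z_{ε+1} + t_{ε+1}) = (z_ε + t_ε) (z_ε ^ (a_ε-1) + s_ε^{(1)} z_ε ^ (a_ε-2) + ⋯)`. -/

/-- The coordinates `t_ε` (`2 < ε < e - 1`) and `s_ε^{(ν)}` (`2 ≤ ε ≤ e - 1`, `1 ≤ ν ≤ a_ε - 1`). -/
inductive Coord (e : ℕ) (a : ℕ → ℕ) : Type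
  | t (ε : ℕ) (h : 2 < ε ∧ ε + 1 < e) : Coord e a
  | s (ε ν : ℕ) (h : 2 ≤ ε ∧ ε < e) (hν : 1 ≤ ν ∧ ν < a ε) : Coord e a

/-- The polynomial ring over `ℂ` in all `t_ε` and `s_ε^{(ν)}`. -/
abbrev BaseRing (e : ℕ) (a : ℕ → ℕ) : Type := MvPolynomial (Coord e a) ℂ

noncomputable section

variable (e : ℕ) (a : ℕ → ℕ)

/-- `t_ε`, with `t_2 = t_{e-1} = 0`. -/
def tPar (ε : ℕ) : BaseRing e a :=
  if h : 2 < ε ∧ ε + 1 < e then MvPolynomial.X (Coord.t ε h) else 0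

/-- `s_ε^{(ν)}`, with `s_ε^{(0)} = 1`. -/
def sPar (ε ν : ℕ) : BaseRing e a :=
  if ν = 0 then 1
  else if h : (2 ≤ ε ∧ ε < e) ∧ (1 ≤ ν ∧ ν < a ε) then MvPolynomial.X (Coord.s ε ν h.1 h.2) else 0

/-- The parameter `l_ε`, normalised to be `0`. -/
def lPar (_ε : ℕ) : BaseRing e a := 0

/-- The parameter `r_ε`; thus `l_ε - r_ε = t_ε`. -/
def rPar (ε : ℕ) : BaseRing e a := -tPar e a ε

/-- `L_ε = z_ε - l_ε`, as a polynomial in `z_ε`. -/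
def LPoly (ε : ℕ) : (BaseRing e a)[X] := X - C (lPar e a ε)

/-- `R_ε = z_ε - r_ε`, as a polynomial in `z_ε`. -/
def RPoly (ε : ℕ) : (BaseRing e a)[X] := X - C (rPar e a ε)

/-- `Z_ε^{(00)} = (z_ε + t_ε) ∑_ν s_ε^{(ν)} z_ε ^ (a_ε - 1 - ν)`. -/
def ZPoly (ε : ℕ) : (BaseRing e a)[X] :=
  RPoly e a ε * ∑ ν ∈ Finset.range (a ε), C (sPar e a ε ν) * X ^ (a ε - 1 - ν)

/-- `Z_ε^{(ij)}`: the quotient of `Z_ε^{(00)}` after `i` divisions with remainder by `L_ε` and `j`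
divisions with remainder by `R_ε` (the order of the divisions is irrelevant). -/
def ZDiv (ε i j : ℕ) : (BaseRing e a)[X] :=
  (fun f => f /ₘ RPoly e a ε)^[j] ((fun f => f /ₘ LPoly e a ε)^[i] (ZPoly e a ε))

/-- The remainders `σ_ε^{(ij)}`, determined by `Z_ε^{(ij)} = L_ε Z_ε^{(i+1,j)} + σ_ε^{(i+1,j)}` and
`Z_ε^{(ij)} = Z_ε^{(i,j+1)} R_ε + σ_ε^{(i,j+1)}`; so `σ_ε^{(i+1,j)} = Z_ε^{(ij)}(l_ε)` and
`σ_ε^{(i,j+1)} = Z_ε^{(ij)}(r_ε)`. There is no `σ_ε^{(00)}`; it gets the dummy value `0`. -/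
def sigma (ε : ℕ) : ℕ → ℕ → BaseRing e a
  | i + 1, j => (ZDiv e a ε i j).eval (lPar e a ε)
  | 0, j + 1 => (ZDiv e a ε 0 j).eval (rPar e a ε)
  | 0, 0 => 0

/-- The monomial `λ(△)` of the coloured triangle `B` with vertex `(δ, ε)`. -/
def lamMon (δ ε : ℕ) (B : Finset (ℕ × ℕ)) : BaseRing e a :=
  ∏ β ∈ Finset.Icc δ ε, sigma e a β
    (rightCount δ ε B β + if alphaNum B β = 1 then 1 else 0) (leftCount δ ε B β)

/-- The monomial `ρ(△)` of the coloured triangle `B` with vertex `(δ, ε)`. -/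
def rhoMon (δ ε : ℕ) (B : Finset (ℕ × ℕ)) : BaseRing e a :=
  ∏ β ∈ Finset.Icc δ ε, sigma e a β
    (rightCount δ ε B β) (leftCount δ ε B β + if alphaNum B β = 1 then 1 else 0)

/-- The ideal `J'`. -/
def JPrime : Ideal (BaseRing e a) :=
  Ideal.span
    ({f | ∃ ε, 2 < ε ∧ ε + 1 < e ∧ f = (lPar e a ε - rPar e a ε) * sigma e a ε 1 1} ∪
     {f | ∃ δ ε B, 2 ≤ δ ∧ δ < ε ∧ ε + 1 < e ∧ IsSparse δ ε B ∧ f = lamMon e a δ ε B} ∪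
     {f | ∃ δ ε B, 2 < δ ∧ δ < ε ∧ ε < e ∧ IsSparse δ ε B ∧ f = rhoMon e a δ ε B})

/-- The ideal of the Artin component, generated by the `σ_ε^{(11)}` with `2 < ε < e - 1`. -/
def artinIdeal : Ideal (BaseRing e a) :=
  Ideal.span {f | ∃ ε, 2 < ε ∧ ε + 1 < e ∧ f = sigma e a ε 1 1}

/-- The ideal of the component belonging to the sparse coloured triangle `B` with vertex
`(2, e - 1)`. It expresses that `t_ε = 0` whenever `α_ε > 1`, and that for every `ε` the polynomial
`Z_ε^{(00)}` is divisible by `z_ε ^ k_ε` if `α_ε > 1`, and by `L_ε ^ i R_ε ^ j` if `α_ε = 1`, where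
`i` and `j` are the numbers of black dots on the right and left half-line of `l_ε`, `i + j = k_ε`:
the corresponding remainders vanish. -/
def componentIdeal (B : Finset (ℕ × ℕ)) : Ideal (BaseRing e a) :=
  Ideal.span
    ({f | ∃ ε, 2 ≤ ε ∧ ε < e ∧ 1 < alphaNum B ε ∧ f = tPar e a ε} ∪
     {f | ∃ ε i j, 2 ≤ ε ∧ ε < e ∧ 1 ≤ i + j ∧ i + j ≤ kNum 2 (e - 1) B ε ∧
        i ≤ rightCount 2 (e - 1) B ε ∧ j ≤ leftCount 2 (e - 1) B ε ∧ f = sigma e a ε i j})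

end

end CyclicQuotient

/-! Read a black dot (x,y) as an arc from x to y. A colouring is sparse exactly when the arcs do not
cross and every arc is subdivided by an intermediate vertex into two arcs or base edges. Adding one
outer vertex, joined to every vertex with no arc above it, turns this into a triangulated polygon.
The degree of β is R_β + L_β + θ_β, which is k_β + 1, and a blow-up inserts an ear. Every nonempty
sparse triangle has an ear, and removing it is the blow-down (`IsTriangulation.exists_ear`,
`IsTriangulation.exists_blowDown`); the combinatorial inductions that compare triangles, and the
construction of a component through a given prime, all run along this move.

Four facts give the minimal primes.

Each P_B is prime. Modulo P_B the polynomial Z_ε is L^p R^q times a free monic cofactor with p + q =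
k_ε, so P_B is the kernel of a parametrisation by a polynomial ring (`componentIdeal_eq_ker`). The
bound k_ε ≤ a_ε leaves room for the cofactor.

Each P_B contains J'. In every generator λ or ρ some factor is already in P_B (`exists_admissible`).
An ear of the generator's triangle is either no ear of B, and then its own factor σ^(11) vanishes,
or common to both triangles, and then it is removed from both. There remains the empty triangle,
treated by a direct walk along its vertices.

Each prime Q containing J' contains some P_B (`VanishingSystem.exists_lies`). Work in the domain
A/Q. If all inner σ^(11) vanish, the empty triangle will do. If σ^(11) is nonzero at c+1, then t
vanishes there and the generators on adjacent pairs force σ^(20) = σ^(11) = 0 at c and σ^(02) =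
σ^(11) = 0 at c+2. Delete c+1 and raise the first index at c and the second index at c+2 by one. The
same equations then hold for one vertex fewer, since λ and ρ of a blow-up are those of the smaller
triangle times a nonzero factor. The blow-up of the triangle found by induction works.

There are no inclusions among the P_B (`eq_of_componentIdeal_le`): an inclusion forces inequalities
between degrees, and peeling off ears turns these into equality of the triangles.

The number of triangles follows from the Catalan recursion. Finally σ^(11) at c+1 lies outside P_B
exactly when c+1 is an ear of B (`sigma_one_one_mem_iff`), which gives the statements on blow-ups.
-/

namespace CyclicQuotient

/-! ## Sparse triangles as partial triangulations -/

/-- The dot `(β, γ)` is black or lies on the (infinite) base line. -/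
def IsBlack (B : Finset (ℕ × ℕ)) (x y : ℕ) : Prop := y = x + 1 ∨ (x, y) ∈ B

/-- Some black dot lies strictly above the line `l_β`. -/
def Above (B : Finset (ℕ × ℕ)) (β : ℕ) : Prop := ∃ p ∈ B, p.1 < β ∧ β < p.2

/-- The black dots, seen as intervals, do not cross, and each of them is subdivided
into two shorter black dots of the extended triangle. -/
structure IsTriangulation (δ ε : ℕ) (B : Finset (ℕ × ℕ)) : Prop where
  colouring : IsColouring δ ε B
  noncrossing : ∀ x y x' y', (x, y) ∈ B → (x', y') ∈ B → x < x' → x' < y → y < y' → False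
  split : ∀ x y, (x, y) ∈ B → ∃ z, x < z ∧ z < y ∧ IsBlack B x z ∧ IsBlack B z y

theorem blackCount_split {B : Finset (ℕ × ℕ)} {α z γ : ℕ} (hB : ∀ p ∈ B, p.1 < p.2)
    (h1 : α < z) (h2 : z < γ)
    (h : ∀ p ∈ B, α ≤ p.1 → p.2 ≤ γ → p ≠ (α, γ) → p.2 ≤ z ∨ z ≤ p.1) :
    blackCount B α γ = blackCount B α z + blackCount B z γ + if (α, γ) ∈ B then 1 else 0 := by
  have e1 : (B.filter fun p => α ≤ p.1 ∧ p.2 ≤ γ) =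
      ((B.filter fun p => α ≤ p.1 ∧ p.2 ≤ z) ∪ (B.filter fun p => z ≤ p.1 ∧ p.2 ≤ γ)) ∪
        (B.filter fun p => p = (α, γ)) := by
    ext p
    simp only [Finset.mem_filter, Finset.mem_union]
    constructor
    · rintro ⟨hp, ha, hg⟩
      by_cases hpe : p = (α, γ)
      · exact Or.inr ⟨hp, hpe⟩
      · rcases h p hp ha hg hpe with h3 | h3
        · exact Or.inl (Or.inl ⟨hp, ha, h3⟩)
        · exact Or.inl (Or.inr ⟨hp, h3, hg⟩)
    · rintro ((⟨hp, h3, h4⟩ | ⟨hp, h3, h4⟩) | ⟨hp, rfl⟩)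
      · exact ⟨hp, h3, by omega⟩
      · exact ⟨hp, by omega, h4⟩
      · exact ⟨hp, le_rfl, le_rfl⟩
  have e2 : (B.filter fun p => p = (α, γ)).card = if (α, γ) ∈ B then 1 else 0 := by
    rw [Finset.filter_eq']
    split_ifs <;> simp
  unfold blackCount
  rw [e1, Finset.card_union_of_disjoint, Finset.card_union_of_disjoint, e2]
  · rw [Finset.disjoint_left]
    intro p hp hq
    simp only [Finset.mem_filter] at hp hq
    have := hB p hp.1
    omega
  · rw [Finset.disjoint_left]
    intro p hp hq
    simp only [Finset.mem_filter, Finset.mem_union] at hp hq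
    obtain ⟨_, rfl⟩ := hq
    simp only at hp
    omega

theorem blackCount_base {δ ε : ℕ} {B : Finset (ℕ × ℕ)} (hB : IsColouring δ ε B) (α : ℕ) :
    blackCount B α (α + 1) = 0 := by
  unfold blackCount
  rw [Finset.card_eq_zero, Finset.filter_eq_empty_iff]
  intro p hp h
  have := hB p hp
  omega

/-- Take the farthest z short of γ joined to α. An arc starting at α cannot pass z by maximality,
and an arc starting strictly between α and z cannot pass z because it would cross (α, z). -/
theorem exists_cut {B : Finset (ℕ × ℕ)}
    (hn : ∀ x y x' y', (x, y) ∈ B → (x', y') ∈ B → x < x' → x' < y → y < y' → False)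
    {α γ : ℕ} (h : α + 2 ≤ γ) :
    ∃ z, α < z ∧ z < γ ∧ IsBlack B α z ∧
      ∀ p ∈ B, α ≤ p.1 → p.2 ≤ γ → p ≠ (α, γ) → p.2 ≤ z ∨ z ≤ p.1 := by
  classical
  obtain ⟨z, hz, hmax⟩ := Finset.exists_max_image
    ((Finset.range γ).filter fun z => α < z ∧ IsBlack B α z) id
    ⟨α + 1, by simp only [Finset.mem_filter, Finset.mem_range]; exact ⟨by omega, by omega, Or.inl rfl⟩⟩
  simp only [Finset.mem_filter, Finset.mem_range, id] at hz hmax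
  refine ⟨z, hz.2.1, hz.1, hz.2.2, ?_⟩
  rintro ⟨x, y⟩ hp hx hy hne
  by_contra! hc
  simp only at hx hy hc
  rcases hx.eq_or_lt with rfl | hx
  · have hyγ : y ≠ γ := fun h => hne (by rw [h])
    have := hmax y ⟨by omega, by omega, Or.inr hp⟩
    omega
  · rcases hz.2.2 with hz' | hz'
    · omega
    · exact hn _ _ _ _ hz' hp hx hc.2 hc.1

/-- Sparseness without truncated subtraction and with the base line included: triangles of height
zero satisfy it too, so cut points need no case distinction. -/
theorem IsSparse.bound {δ ε : ℕ} {B : Finset (ℕ × ℕ)} (hB : IsSparse δ ε B) {α β : ℕ}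
    (h1 : δ ≤ α) (h2 : α < β) (h3 : β ≤ ε) :
    blackCount B α β + α + 1 ≤ β ∧ (blackCount B α β + α + 1 = β ↔ IsBlack B α β) := by
  by_cases h : α + 2 ≤ β
  · obtain ⟨h4, h5⟩ := hB.2 α β h1 h h3
    refine ⟨by omega, ?_⟩
    unfold IsBlack
    rw [← h5]
    omega
  · obtain rfl : β = α + 1 := by omega
    have := blackCount_base hB.1 α
    simp [this, IsBlack]

/-- Both properties come from counting. For crossing arcs, inclusion-exclusion on their two full
triangles fills the hull up to its height without using the hull's vertex. For the splitting, the
two halves at a cut must together contain exactly one dot less than the whole. -/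
theorem IsSparse.isTriangulation {δ ε : ℕ} {B : Finset (ℕ × ℕ)} (hB : IsSparse δ ε B) :
    IsTriangulation δ ε B := by
  have hlt : ∀ p ∈ B, p.1 < p.2 := fun p hp => by have := hB.1 p hp; omega
  have hn : ∀ x y x' y', (x, y) ∈ B → (x', y') ∈ B → x < x' → x' < y → y < y' → False := by
    intro x y x' y' h h' h1 h2 h3
    have b := hB.1 _ h
    have b' := hB.1 _ h'
    simp only at b b'
    have c := (hB.bound b.1 (by omega : x < y) b.2.2).2.2 (Or.inr h)
    have c' := (hB.bound b'.1 (by omega : x' < y') b'.2.2).2.2 (Or.inr h')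
    have ci := (hB.bound (by omega : δ ≤ x') h2 b.2.2).1
    have cu := hB.bound b.1 (by omega : x < y') b'.2.2
    have e1 : (B.filter fun p => x ≤ p.1 ∧ p.2 ≤ y) ∩ (B.filter fun p => x' ≤ p.1 ∧ p.2 ≤ y') =
        B.filter fun p => x' ≤ p.1 ∧ p.2 ≤ y := by
      ext p
      simp only [Finset.mem_inter, Finset.mem_filter]
      constructor
      · rintro ⟨⟨h, _, _⟩, _, _, _⟩; exact ⟨h, by omega, by omega⟩
      · rintro ⟨h, _, _⟩; exact ⟨⟨h, by omega, by omega⟩, h, by omega, by omega⟩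
    have e2 : (B.filter fun p => x ≤ p.1 ∧ p.2 ≤ y) ∪ (B.filter fun p => x' ≤ p.1 ∧ p.2 ≤ y') ⊆
        (B.filter fun p => x ≤ p.1 ∧ p.2 ≤ y').erase (x, y') := by
      intro p
      simp only [Finset.mem_union, Finset.mem_filter, Finset.mem_erase]
      rintro (⟨hp, h4, h5⟩ | ⟨hp, h4, h5⟩)
      · exact ⟨by rintro rfl; simp only at h5; omega, hp, h4, by omega⟩
      · exact ⟨by rintro rfl; simp only at h4; omega, hp, by omega, h5⟩
    have e3 := Finset.card_union_add_card_inter (B.filter fun p => x ≤ p.1 ∧ p.2 ≤ y)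
      (B.filter fun p => x' ≤ p.1 ∧ p.2 ≤ y')
    rw [e1] at e3
    have e4 := Finset.card_le_card e2
    unfold blackCount at c c' ci cu
    -- The dots of the two crossing triangles already reach the height of the hull, so equality
    -- holds and its vertex is black; that vertex is one dot too many.
    have e5 : (x, y') ∈ B := by
      have h6 := cu.2.1 (by
        have := Finset.card_erase_le (s := B.filter fun p => x ≤ p.1 ∧ p.2 ≤ y') (a := (x, y'))
        omega)
      rcases h6 with h6 | h6
      · omega
      · exact h6
    rw [Finset.card_erase_of_mem (by simp [e5])] at e4
    have : 0 < (B.filter fun p => x ≤ p.1 ∧ p.2 ≤ y').card :=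
      Finset.card_pos.2 ⟨(x, y'), by simp [e5]⟩
    omega
  refine ⟨hB.1, hn, ?_⟩
  intro x y h
  have b := hB.1 _ h
  simp only at b
  obtain ⟨z, h1, h2, h3, h4⟩ := exists_cut hn b.2.1
  refine ⟨z, h1, h2, h3, ?_⟩
  -- The left half is at most full, so the right half has to be full, hence its vertex is black.
  have c := blackCount_split hlt h1 h2 h4
  rw [if_pos h] at c
  have c0 := (hB.bound b.1 (by omega : x < y) b.2.2).2.2 (Or.inr h)
  have c1 := (hB.bound b.1 h1 (by omega : z ≤ ε)).1
  have c2 := hB.bound (by omega : δ ≤ z) h2 b.2.2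
  apply c2.2.1
  omega

/-- Induction on the height. The heights of the two halves at a cut add up to one less than the
height of the whole, and the missing dot is the vertex, if it is black. -/
theorem IsTriangulation.bound {δ ε : ℕ} {B : Finset (ℕ × ℕ)} (hB : IsTriangulation δ ε B) :
    ∀ n α β : ℕ, β = α + n + 1 →
    blackCount B α β + α + 1 ≤ β ∧ (blackCount B α β + α + 1 = β ↔ IsBlack B α β) := by
  have hlt : ∀ p ∈ B, p.1 < p.2 := fun p hp => by have := hB.colouring p hp; omega
  intro n
  induction n using Nat.strong_induction_on with
  | _ n ih =>
    intro α β hβ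
    rcases Nat.eq_zero_or_pos n with rfl | hn
    · subst hβ
      have := blackCount_base hB.colouring α
      simp [this, IsBlack]
    by_cases hb : (α, β) ∈ B
    · obtain ⟨z, h1, h2, h3, h4⟩ := hB.split α β hb
      have hc := blackCount_split hlt h1 h2 (by
        rintro ⟨x, y⟩ hp hx hy hne
        by_contra! hc
        simp only at hx hy hc
        rcases hx.eq_or_lt with rfl | hx
        · have hyγ : y ≠ β := fun h => hne (by rw [h])
          rcases h4 with h4 | h4
          · omega
          · exact hB.noncrossing _ _ _ _ hp h4 h1 hc.1 (by omega)
        · rcases h3 with h3 | h3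
          · omega
          · exact hB.noncrossing _ _ _ _ h3 hp hx hc.2 hc.1)
      rw [if_pos hb] at hc
      have i1 := (ih (z - α - 1) (by omega) α z (by omega)).2.2 h3
      have i2 := (ih (β - z - 1) (by omega) z β (by omega)).2.2 h4
      exact ⟨by omega, fun _ => Or.inr hb, fun _ => by omega⟩
    · obtain ⟨z, h1, h2, h3, h4⟩ := exists_cut hB.noncrossing
        (by omega : α + 2 ≤ β)
      have hc := blackCount_split hlt h1 h2 h4
      rw [if_neg hb] at hc
      have i1 := (ih (z - α - 1) (by omega) α z (by omega)).1
      have i2 := (ih (β - z - 1) (by omega) z β (by omega)).1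
      refine ⟨by omega, fun _ => by omega, ?_⟩
      rintro (h | h)
      · omega
      · exact absurd h hb

theorem isSparse_iff {δ ε : ℕ} {B : Finset (ℕ × ℕ)} :
    IsSparse δ ε B ↔ IsTriangulation δ ε B := by
  refine ⟨IsSparse.isTriangulation, fun h => ⟨h.colouring, fun α β h1 h2 h3 => ?_⟩⟩
  obtain ⟨h4, h5⟩ := h.bound (β - α - 1) α β (by omega)
  refine ⟨by omega, ?_⟩
  constructor
  · intro h6
    rcases h5.1 (by omega) with h7 | h7
    · omega
    · exact h7
  · intro h6
    have := h5.2 (Or.inr h6)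
    omega

theorem isTriangulation_empty (δ ε : ℕ) : IsTriangulation δ ε ∅ :=
  ⟨by simp [IsColouring], by simp, by simp⟩

/-- Descend from any arc above β to its half that still passes over β; the shortest one can only be
split at β itself. -/
theorem IsTriangulation.exists_split_above {δ ε : ℕ} {B : Finset (ℕ × ℕ)}
    (hB : IsTriangulation δ ε B) {β : ℕ} (h : Above B β) :
    ∃ x y, (x, y) ∈ B ∧ x < β ∧ β < y ∧ IsBlack B x β ∧ IsBlack B β y := by
  obtain ⟨⟨x, y⟩, hp, hx, hy⟩ := h
  simp only at hx hy
  induction hn : y - x using Nat.strong_induction_on generalizing x y with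
  | _ n ih =>
    obtain ⟨z, h1, h2, h3, h4⟩ := hB.split x y hp
    rcases lt_trichotomy z β with h | rfl | h
    · rcases h4 with h4 | h4
      · omega
      · exact ih (y - z) (by omega) z y h4 h hy rfl
    · exact ⟨x, y, hp, hx, hy, h3, h4⟩
    · rcases h3 with h3 | h3
      · omega
      · exact ih (z - x) (by omega) x z h3 hx h rfl

theorem IsTriangulation.exists_ear {δ ε : ℕ} {B : Finset (ℕ × ℕ)}
    (hB : IsTriangulation δ ε B) (h : B ≠ ∅) :
    ∃ x, (x, x + 2) ∈ B := by
  obtain ⟨⟨x, y⟩, hp⟩ := Finset.nonempty_of_ne_empty h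
  induction hn : y - x using Nat.strong_induction_on generalizing x y with
  | _ n ih =>
    obtain ⟨z, h1, h2, h3, h4⟩ := hB.split x y hp
    rcases h3 with rfl | h3
    · rcases h4 with rfl | h4
      · exact ⟨x, hp⟩
      · exact ih _ (by omega) _ _ h4 rfl
    · exact ih _ (by omega) _ _ h3 rfl

theorem one_le_weight (B : Finset (ℕ × ℕ)) (δ ε : ℕ) : 1 ≤ weight B δ ε := by
  rw [weight]
  omega

/-- Weights are positive, so of `alphaNum` only the presence or absence of an arc above the vertex
matters from here on. -/
theorem alphaNum_eq_one_iff {B : Finset (ℕ × ℕ)} {β : ℕ} : alphaNum B β = 1 ↔ ¬ Above B β := by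
  unfold alphaNum Above
  simp only [Nat.add_eq_left, Finset.sum_eq_zero_iff, Finset.mem_filter, not_exists, not_and]
  constructor
  · intro h p hp h1 h2
    have := h p ⟨hp, h1, h2⟩
    have := one_le_weight B p.1 p.2
    omega
  · rintro h p ⟨hp, h1, h2⟩
    exact absurd h2 (h p hp h1)

theorem one_lt_alphaNum_iff {B : Finset (ℕ × ℕ)} {β : ℕ} : 1 < alphaNum B β ↔ Above B β := by
  have h : 1 ≤ alphaNum B β := by unfold alphaNum; omega
  have := alphaNum_eq_one_iff (B := B) (β := β)
  rw [← not_iff_not, ← this]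
  omega

/-! ## Counting black dots on a line -/

theorem mem_extended {δ ε : ℕ} {B : Finset (ℕ × ℕ)} {x y : ℕ} :
    (x, y) ∈ extended δ ε B ↔ (x, y) ∈ B ∨ (δ ≤ x ∧ x < ε ∧ y = x + 1) := by
  unfold extended
  simp only [Finset.mem_union, Finset.mem_image, Finset.mem_Ico, Prod.mk.injEq]
  refine or_congr_right ⟨?_, ?_⟩
  · rintro ⟨_, h, rfl, rfl⟩; exact ⟨h.1, h.2, rfl⟩
  · rintro ⟨h1, h2, rfl⟩; exact ⟨x, ⟨h1, h2⟩, rfl, rfl⟩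

theorem kNum_eq {δ ε : ℕ} {B : Finset (ℕ × ℕ)} (hB : IsColouring δ ε B) (β : ℕ) :
    kNum δ ε B β = rightCount δ ε B β + leftCount δ ε B β - if alphaNum B β = 1 then 0 else 1 := by
  unfold kNum rightCount leftCount
  rw [Finset.filter_or, Finset.card_union_of_disjoint]
  rw [Finset.disjoint_left]
  rintro ⟨x, y⟩ h1 h2
  simp only [Finset.mem_filter, mem_extended] at h1 h2
  rcases h1.1 with h3 | h3
  · have := hB _ h3
    simp only at this
    omega
  · omega

variable {δ ε : ℕ} {B : Finset (ℕ × ℕ)}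

theorem one_le_rightCount {β : ℕ} (h1 : δ ≤ β) (h2 : β < ε) : 1 ≤ rightCount δ ε B β :=
  Finset.card_pos.2 ⟨(β, β + 1), by simp [mem_extended, h1, h2]⟩

theorem one_le_leftCount {β : ℕ} (h1 : δ < β) (h2 : β ≤ ε) : 1 ≤ leftCount δ ε B β :=
  Finset.card_pos.2 ⟨(β - 1, β), by
    simp only [Finset.mem_filter, mem_extended]
    exact ⟨Or.inr (by omega), trivial⟩⟩

theorem rightCount_last (hB : IsColouring δ ε B) : rightCount δ ε B ε = 0 := by
  unfold rightCount
  rw [Finset.card_eq_zero, Finset.filter_eq_empty_iff]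
  rintro ⟨x, y⟩ h rfl
  rw [mem_extended] at h
  rcases h with h | h
  · have := hB _ h
    simp only at this
    omega
  · exact lt_irrefl _ h.2.1

theorem leftCount_first (hB : IsColouring δ ε B) : leftCount δ ε B δ = 0 := by
  unfold leftCount
  rw [Finset.card_eq_zero, Finset.filter_eq_empty_iff]
  rintro ⟨x, y⟩ h rfl
  rw [mem_extended] at h
  rcases h with h | h
  · have := hB _ h
    simp only at this
    omega
  · simp only at h
    omega

theorem two_le_rightCount {β y y' : ℕ} (h : (β, y) ∈ extended δ ε B)
    (h' : (β, y') ∈ extended δ ε B) (hy : y ≠ y') : 2 ≤ rightCount δ ε B β := by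
  have : ({(β, y), (β, y')} : Finset (ℕ × ℕ)) ⊆ (extended δ ε B).filter fun p => p.1 = β := by
    intro p
    simp only [Finset.mem_insert, Finset.mem_singleton, Finset.mem_filter]
    rintro (rfl | rfl) <;> simp_all
  refine le_trans ?_ (Finset.card_le_card this)
  rw [Finset.card_pair (by simp [hy])]

theorem two_le_leftCount {β x x' : ℕ} (h : (x, β) ∈ extended δ ε B)
    (h' : (x', β) ∈ extended δ ε B) (hx : x ≠ x') : 2 ≤ leftCount δ ε B β := by
  have : ({(x, β), (x', β)} : Finset (ℕ × ℕ)) ⊆ (extended δ ε B).filter fun p => p.2 = β := by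
    intro p
    simp only [Finset.mem_insert, Finset.mem_singleton, Finset.mem_filter]
    rintro (rfl | rfl) <;> simp_all
  refine le_trans ?_ (Finset.card_le_card this)
  rw [Finset.card_pair (by simp [hx])]

theorem three_le_rightCount {β y y' y'' : ℕ} (h : (β, y) ∈ extended δ ε B)
    (h' : (β, y') ∈ extended δ ε B) (h'' : (β, y'') ∈ extended δ ε B)
    (hy : y ≠ y') (hy' : y ≠ y'') (hy'' : y' ≠ y'') : 3 ≤ rightCount δ ε B β := by
  have : ({(β, y), (β, y'), (β, y'')} : Finset (ℕ × ℕ)) ⊆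
      (extended δ ε B).filter fun p => p.1 = β := by
    intro p
    simp only [Finset.mem_insert, Finset.mem_singleton, Finset.mem_filter]
    rintro (rfl | rfl | rfl) <;> simp_all
  refine le_trans ?_ (Finset.card_le_card this)
  rw [Finset.card_eq_three.2 ⟨_, _, _, by simpa using hy, by simpa using hy', by simpa using hy'', rfl⟩]

theorem three_le_leftCount {β x x' x'' : ℕ} (h : (x, β) ∈ extended δ ε B)
    (h' : (x', β) ∈ extended δ ε B) (h'' : (x'', β) ∈ extended δ ε B)
    (hx : x ≠ x') (hx' : x ≠ x'') (hx'' : x' ≠ x'') : 3 ≤ leftCount δ ε B β := by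
  have : ({(x, β), (x', β), (x'', β)} : Finset (ℕ × ℕ)) ⊆
      (extended δ ε B).filter fun p => p.2 = β := by
    intro p
    simp only [Finset.mem_insert, Finset.mem_singleton, Finset.mem_filter]
    rintro (rfl | rfl | rfl) <;> simp_all
  refine le_trans ?_ (Finset.card_le_card this)
  rw [Finset.card_eq_three.2 ⟨_, _, _, by simpa using hx, by simpa using hx', by simpa using hx'', rfl⟩]

theorem rightCount_empty {β : ℕ} (h1 : δ ≤ β) (h2 : β < ε) : rightCount δ ε ∅ β = 1 := by
  unfold rightCount
  rw [Finset.card_eq_one]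
  refine ⟨(β, β + 1), ?_⟩
  ext ⟨x, y⟩
  simp only [Finset.mem_filter, mem_extended, Finset.mem_singleton, Prod.mk.injEq,
    Finset.notMem_empty, false_or]
  omega

theorem leftCount_empty {β : ℕ} (h1 : δ < β) (h2 : β ≤ ε) : leftCount δ ε ∅ β = 1 := by
  unfold leftCount
  rw [Finset.card_eq_one]
  refine ⟨(β - 1, β), ?_⟩
  ext ⟨x, y⟩
  simp only [Finset.mem_filter, mem_extended, Finset.mem_singleton, Prod.mk.injEq,
    Finset.notMem_empty, false_or]
  omega

theorem not_above_empty (β : ℕ) : ¬ Above ∅ β := by simp [Above]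

theorem IsTriangulation.above_bounds (hB : IsTriangulation δ ε B) {β : ℕ} (h : Above B β) :
    δ < β ∧ β < ε := by
  obtain ⟨p, hp, h1, h2⟩ := h
  have := hB.colouring p hp
  omega

/-- The vertex `β` is an ear as soon as it lies below a black dot and carries only dots of the
base line. -/
theorem IsTriangulation.ear_of_counts (hB : IsTriangulation δ ε B) {β : ℕ} (h : Above B (β + 1))
    (hR : rightCount δ ε B (β + 1) ≤ 1) (hL : leftCount δ ε B (β + 1) ≤ 1) : (β, β + 2) ∈ B := by
  obtain ⟨x, y, hp, hx, hy, h1, h2⟩ := hB.exists_split_above h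
  have hb := hB.colouring _ hp
  simp only at hb
  have hy' : y = β + 2 := by
    rcases h2 with h2 | h2
    · exact h2
    · by_contra hne
      have := two_le_rightCount (δ := δ) (ε := ε) (mem_extended.2 (Or.inl h2))
        (mem_extended.2 (Or.inr ⟨by omega, by omega, rfl⟩)) hne
      omega
  have hx' : x = β := by
    rcases h1 with h1 | h1
    · omega
    · by_contra hne
      have := two_le_leftCount (δ := δ) (ε := ε) (x := x) (x' := β) (mem_extended.2 (Or.inl h1))
        (mem_extended.2 (Or.inr ⟨by omega, by omega, rfl⟩)) hne
      omega
  rw [hx', hy'] at hp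
  exact hp

end CyclicQuotient

namespace CyclicQuotient

/-! ## Blowing up and blowing down -/

theorem shift_lt_shift {ε x y : ℕ} : shift ε x < shift ε y ↔ x < y := by
  unfold shift; split_ifs <;> omega

theorem shift_inj {ε x y : ℕ} : shift ε x = shift ε y ↔ x = y := by
  unfold shift; split_ifs <;> omega

theorem shift_ne (ε x : ℕ) : shift ε x ≠ ε := by
  unfold shift; split_ifs <;> omega

theorem exists_shift {ε x : ℕ} (h : x ≠ ε) : ∃ y, x = shift ε y := by
  rcases lt_or_gt_of_ne h with h | h
  · exact ⟨x, by simp [shift, h]⟩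
  · exact ⟨x - 1, by unfold shift; split_ifs <;> omega⟩

/-- The left end of the blow-up at `c + 1` of a triangle with left end `δ`. -/
def blowLeft (c δ : ℕ) : ℕ := if δ ≤ c + 1 then δ else δ + 1

/-- The right end of the blow-up at `c + 1` of a triangle with right end `η`. -/
def blowRight (c η : ℕ) : ℕ := if η < c then η else η + 1

theorem blowLeft_le_shift {c δ x : ℕ} : blowLeft c δ ≤ shift (c + 1) x ↔ δ ≤ x := by
  unfold blowLeft shift; split_ifs <;> omega

theorem shift_le_blowRight {c η x : ℕ} : shift (c + 1) x ≤ blowRight c η ↔ x ≤ η := by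
  unfold blowRight shift; split_ifs <;> omega

theorem shift_add_one {c x : ℕ} (h : x ≠ c) : shift (c + 1) (x + 1) = shift (c + 1) x + 1 := by
  unfold shift; split_ifs <;> omega

theorem shift_self (c : ℕ) : shift (c + 1) c = c := by simp [shift]

theorem shift_succ_self (c : ℕ) : shift (c + 1) (c + 1) = c + 2 := by simp [shift]

variable {δ η c : ℕ} {B : Finset (ℕ × ℕ)}

/-- The base edge (c, c+1) is the only one stretched by the shift: it becomes the new ear, while the
other base edges stay on the base line and are deleted. -/
theorem mem_blowUp (hB : IsColouring δ η B) {x y : ℕ} :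
    (x, y) ∈ blowUp δ η (c + 1) B ↔
      (∃ x' y', (x', y') ∈ B ∧ x = shift (c + 1) x' ∧ y = shift (c + 1) y') ∨
      (δ ≤ c ∧ c < η ∧ x = c ∧ y = c + 2) := by
  unfold blowUp
  simp only [Finset.mem_filter, Finset.mem_image, Prod.exists, Prod.mk.injEq, mem_extended]
  constructor
  · rintro ⟨⟨x', y', h | ⟨h1, h2, rfl⟩, rfl, rfl⟩, hxy⟩
    · exact Or.inl ⟨x', y', h, rfl, rfl⟩
    · by_cases hx : x' = c
      · subst hx
        exact Or.inr ⟨h1, h2, shift_self _, shift_succ_self _⟩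
      · rw [shift_add_one hx] at hxy
        omega
  · rintro (⟨x', y', h, rfl, rfl⟩ | ⟨h1, h2, rfl, rfl⟩)
    · refine ⟨⟨x', y', Or.inl h, rfl, rfl⟩, ?_⟩
      have := hB _ h
      unfold shift
      split_ifs <;> omega
    · exact ⟨⟨x, x + 1, Or.inr ⟨h1, h2, rfl⟩, shift_self _, shift_succ_self _⟩, le_rfl⟩

theorem isBlack_blowUp (hB : IsColouring δ η B) {x y : ℕ} (h : IsBlack B x y) (hx : δ ≤ x)
    (hy : y ≤ η) : IsBlack (blowUp δ η (c + 1) B) (shift (c + 1) x) (shift (c + 1) y) := by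
  rcases h with rfl | h
  · by_cases hc : x = c
    · subst hc
      exact Or.inr ((mem_blowUp hB).2 (Or.inr ⟨hx, hy, shift_self _, shift_succ_self _⟩))
    · exact Or.inl (shift_add_one hc)
  · exact Or.inr ((mem_blowUp hB).2 (Or.inl ⟨x, y, h, rfl, rfl⟩))

theorem isTriangulation_blowUp (hB : IsTriangulation δ η B) (c : ℕ) :
    IsTriangulation (blowLeft c δ) (blowRight c η) (blowUp δ η (c + 1) B) := by
  have hcol := hB.colouring
  refine ⟨?_, ?_, ?_⟩
  · rintro ⟨x, y⟩ h
    rw [mem_blowUp hcol] at h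
    rcases h with ⟨x', y', h, rfl, rfl⟩ | ⟨h1, h2, rfl, rfl⟩
    · have := hcol _ h
      refine ⟨blowLeft_le_shift.2 this.1, ?_, shift_le_blowRight.2 this.2.2⟩
      simp only at this ⊢
      unfold shift
      split_ifs <;> omega
    · refine ⟨?_, le_rfl, ?_⟩
      · simp only [blowLeft]; split_ifs <;> omega
      · simp only [blowRight]; split_ifs <;> omega
  · intro x y x' y' h h' h1 h2 h3
    rw [mem_blowUp hcol] at h h'
    rcases h with ⟨u, v, h, rfl, rfl⟩ | ⟨_, _, rfl, rfl⟩
    · rcases h' with ⟨u', v', h', rfl, rfl⟩ | ⟨_, _, rfl, rfl⟩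
      · rw [shift_lt_shift] at h1 h2 h3
        exact hB.noncrossing _ _ _ _ h h' h1 h2 h3
      · have := shift_ne (x' + 1) v
        omega
    · rcases h' with ⟨u', v', h', rfl, rfl⟩ | ⟨_, _, rfl, rfl⟩
      · have := shift_ne (x + 1) u'
        omega
      · omega
  · intro x y h
    rw [mem_blowUp hcol] at h
    rcases h with ⟨u, v, h, rfl, rfl⟩ | ⟨h1, h2, rfl, rfl⟩
    · obtain ⟨z, h1, h2, h3, h4⟩ := hB.split _ _ h
      have b := hcol _ h
      simp only at b
      exact ⟨shift (c + 1) z, shift_lt_shift.2 h1, shift_lt_shift.2 h2,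
        isBlack_blowUp hcol h3 b.1 (by omega), isBlack_blowUp hcol h4 (by omega) b.2.2⟩
    · exact ⟨x + 1, by omega, by omega, Or.inl rfl, Or.inl rfl⟩

theorem extended_blowUp (hB : IsColouring δ η B) {x y : ℕ} :
    (x, y) ∈ extended (blowLeft c δ) (blowRight c η) (blowUp δ η (c + 1) B) ↔
      (∃ x' y', (x', y') ∈ extended δ η B ∧ x = shift (c + 1) x' ∧ y = shift (c + 1) y') ∨
      (δ ≤ c ∧ c ≤ η ∧ x = c ∧ y = c + 1) ∨ (δ ≤ c + 1 ∧ c + 1 ≤ η ∧ x = c + 1 ∧ y = c + 2) := by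
  rw [mem_extended, mem_blowUp hB]
  simp only [mem_extended]
  constructor
  · rintro ((⟨x', y', h, rfl, rfl⟩ | ⟨h1, h2, rfl, rfl⟩) | ⟨h1, h2, rfl⟩)
    · exact Or.inl ⟨x', y', Or.inl h, rfl, rfl⟩
    · exact Or.inl ⟨x, x + 1, Or.inr ⟨h1, h2, rfl⟩, (shift_self _).symm, (shift_succ_self _).symm⟩
    · rcases eq_or_ne x (c + 1) with rfl | hx
      · right; right
        unfold blowLeft at h1
        unfold blowRight at h2
        refine ⟨?_, ?_, rfl, rfl⟩ <;> split_ifs at h1 h2 <;> omega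
      · obtain ⟨u, rfl⟩ := exists_shift hx
        rcases eq_or_ne u c with rfl | hu
        · right; left
          rw [blowLeft_le_shift] at h1
          have h3 := shift_le_blowRight.1 h2.le
          exact ⟨h1, h3, shift_self _, by rw [shift_self]⟩
        · left
          refine ⟨u, u + 1, Or.inr ⟨blowLeft_le_shift.1 h1, ?_, rfl⟩, rfl, (shift_add_one hu).symm⟩
          have h3 := Nat.succ_le_of_lt h2
          rw [Nat.succ_eq_add_one, ← shift_add_one hu, shift_le_blowRight] at h3
          exact h3
  · rintro (⟨x', y', h | ⟨h1, h2, rfl⟩, rfl, rfl⟩ | ⟨h1, h2, rfl, rfl⟩ | ⟨h1, h2, rfl, rfl⟩)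
    · exact Or.inl (Or.inl ⟨x', y', h, rfl, rfl⟩)
    · rcases eq_or_ne x' c with rfl | hu
      · exact Or.inl (Or.inr ⟨h1, h2, shift_self _, shift_succ_self _⟩)
      · refine Or.inr ⟨blowLeft_le_shift.2 h1, ?_, shift_add_one hu⟩
        have h3 := (shift_le_blowRight (c := c)).2 (Nat.succ_le_of_lt h2)
        rw [Nat.succ_eq_add_one, shift_add_one hu] at h3
        exact h3
    · right
      unfold blowLeft blowRight
      refine ⟨?_, ?_, rfl⟩ <;> split_ifs <;> omega
    · right
      unfold blowLeft blowRight
      refine ⟨?_, ?_, rfl⟩ <;> split_ifs <;> omega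

theorem shiftPair_injective (ε : ℕ) :
    Function.Injective fun p : ℕ × ℕ => (shift ε p.1, shift ε p.2) := by
  rintro ⟨x, y⟩ ⟨x', y'⟩ h
  simp only [Prod.mk.injEq, shift_inj] at h
  rw [h.1, h.2]

/-- Old arcs are carried over one to one. The only new dot on an old right half-line is the base
edge from c to the inserted vertex. -/
theorem rightCount_blowUp (hB : IsColouring δ η B) {β : ℕ} (h1 : δ ≤ β) (h2 : β ≤ η) :
    rightCount (blowLeft c δ) (blowRight c η) (blowUp δ η (c + 1) B) (shift (c + 1) β) =
      rightCount δ η B β + if β = c then 1 else 0 := by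
  unfold rightCount
  have e : ((extended (blowLeft c δ) (blowRight c η) (blowUp δ η (c + 1) B)).filter
      fun p => p.1 = shift (c + 1) β) =
      ((extended δ η B).filter fun p => p.1 = β).image
        (fun p => (shift (c + 1) p.1, shift (c + 1) p.2)) ∪
        if β = c then {(c, c + 1)} else ∅ := by
    ext ⟨x, y⟩
    simp only [Finset.mem_filter, Finset.mem_union, Finset.mem_image, Prod.exists, Prod.mk.injEq,
      extended_blowUp hB]
    constructor
    · rintro ⟨⟨x', y', h, rfl, rfl⟩ | ⟨_, _, rfl, rfl⟩ | ⟨_, _, rfl, rfl⟩, h'⟩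
      · exact Or.inl ⟨x', y', ⟨h, shift_inj.1 h'⟩, rfl, rfl⟩
      · right
        have : β = x := by
          rw [← shift_inj (ε := x + 1), ← h', shift_self]
        simp [this]
      · exact absurd h'.symm (shift_ne _ _)
    · rintro (⟨x', y', ⟨h, rfl⟩, rfl, rfl⟩ | h)
      · exact ⟨Or.inl ⟨x', y', h, rfl, rfl⟩, rfl⟩
      · split_ifs at h with hc
        · subst hc
          simp only [Finset.mem_singleton, Prod.mk.injEq] at h
          obtain ⟨rfl, rfl⟩ := h
          exact ⟨Or.inr (Or.inl ⟨h1, h2, rfl, rfl⟩), (shift_self _).symm⟩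
        · simp at h
  rw [e, Finset.card_union_of_disjoint, Finset.card_image_of_injective _ (shiftPair_injective _)]
  · split_ifs <;> simp
  · rw [Finset.disjoint_left]
    rintro ⟨x, y⟩ h h'
    split_ifs at h'
    · simp only [Finset.mem_singleton, Prod.mk.injEq] at h'
      simp only [Finset.mem_image, Prod.mk.injEq] at h
      obtain ⟨p, _, _, h⟩ := h
      rw [h'.2] at h
      exact shift_ne _ _ h
    · simp at h'

theorem leftCount_blowUp (hB : IsColouring δ η B) {β : ℕ} (h1 : δ ≤ β) (h2 : β ≤ η) :
    leftCount (blowLeft c δ) (blowRight c η) (blowUp δ η (c + 1) B) (shift (c + 1) β) =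
      leftCount δ η B β + if β = c + 1 then 1 else 0 := by
  unfold leftCount
  have e : ((extended (blowLeft c δ) (blowRight c η) (blowUp δ η (c + 1) B)).filter
      fun p => p.2 = shift (c + 1) β) =
      ((extended δ η B).filter fun p => p.2 = β).image
        (fun p => (shift (c + 1) p.1, shift (c + 1) p.2)) ∪
        if β = c + 1 then {(c + 1, c + 2)} else ∅ := by
    ext ⟨x, y⟩
    simp only [Finset.mem_filter, Finset.mem_union, Finset.mem_image, Prod.exists, Prod.mk.injEq,
      extended_blowUp hB]
    constructor
    · rintro ⟨⟨x', y', h, rfl, rfl⟩ | ⟨_, _, rfl, rfl⟩ | ⟨_, _, rfl, rfl⟩, h'⟩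
      · exact Or.inl ⟨x', y', ⟨h, shift_inj.1 h'⟩, rfl, rfl⟩
      · exact absurd h'.symm (shift_ne _ _)
      · right
        have : β = c + 1 := by
          rw [← shift_inj (ε := c + 1), ← h', shift_succ_self]
        simp [this]
    · rintro (⟨x', y', ⟨h, rfl⟩, rfl, rfl⟩ | h)
      · exact ⟨Or.inl ⟨x', y', h, rfl, rfl⟩, rfl⟩
      · split_ifs at h with hc
        · subst hc
          simp only [Finset.mem_singleton, Prod.mk.injEq] at h
          obtain ⟨rfl, rfl⟩ := h
          exact ⟨Or.inr (Or.inr ⟨h1, h2, rfl, rfl⟩), (shift_succ_self _).symm⟩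
        · simp at h
  rw [e, Finset.card_union_of_disjoint, Finset.card_image_of_injective _ (shiftPair_injective _)]
  · split_ifs <;> simp
  · rw [Finset.disjoint_left]
    rintro ⟨x, y⟩ h h'
    split_ifs at h'
    · simp only [Finset.mem_singleton, Prod.mk.injEq] at h'
      simp only [Finset.mem_image, Prod.mk.injEq] at h
      obtain ⟨p, _, h, _⟩ := h
      rw [h'.1] at h
      exact shift_ne _ _ h
    · simp at h'

theorem rightCount_blowUp_self (hB : IsColouring δ η B) (h1 : δ ≤ c + 1) (h2 : c + 1 ≤ η) :
    rightCount (blowLeft c δ) (blowRight c η) (blowUp δ η (c + 1) B) (c + 1) = 1 := by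
  unfold rightCount
  rw [Finset.card_eq_one]
  refine ⟨(c + 1, c + 2), ?_⟩
  ext ⟨x, y⟩
  simp only [Finset.mem_filter, extended_blowUp hB, Finset.mem_singleton, Prod.mk.injEq]
  constructor
  · rintro ⟨⟨x', y', h, rfl, rfl⟩ | ⟨_, _, rfl, rfl⟩ | ⟨_, _, rfl, rfl⟩, h'⟩
    · exact absurd h' (shift_ne _ _)
    · omega
    · exact ⟨rfl, rfl⟩
  · rintro ⟨rfl, rfl⟩
    exact ⟨Or.inr (Or.inr ⟨h1, h2, rfl, rfl⟩), rfl⟩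

theorem leftCount_blowUp_self (hB : IsColouring δ η B) (h1 : δ ≤ c) (h2 : c ≤ η) :
    leftCount (blowLeft c δ) (blowRight c η) (blowUp δ η (c + 1) B) (c + 1) = 1 := by
  unfold leftCount
  rw [Finset.card_eq_one]
  refine ⟨(c, c + 1), ?_⟩
  ext ⟨x, y⟩
  simp only [Finset.mem_filter, extended_blowUp hB, Finset.mem_singleton, Prod.mk.injEq]
  constructor
  · rintro ⟨⟨x', y', h, rfl, rfl⟩ | ⟨_, _, rfl, rfl⟩ | ⟨_, _, rfl, rfl⟩, h'⟩
    · exact absurd h' (shift_ne _ _)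
    · exact ⟨rfl, rfl⟩
    · omega
  · rintro ⟨rfl, rfl⟩
    exact ⟨Or.inr (Or.inl ⟨h1, h2, rfl, rfl⟩), rfl⟩

theorem above_blowUp (hB : IsColouring δ η B) {β : ℕ} :
    Above (blowUp δ η (c + 1) B) (shift (c + 1) β) ↔ Above B β := by
  constructor
  · rintro ⟨⟨x, y⟩, hp, hx, hy⟩
    rw [mem_blowUp hB] at hp
    rcases hp with ⟨x', y', h, rfl, rfl⟩ | ⟨_, _, rfl, rfl⟩
    · exact ⟨_, h, shift_lt_shift.1 hx, shift_lt_shift.1 hy⟩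
    · have := shift_ne (x + 1) β
      simp only at hx hy
      omega
  · rintro ⟨⟨x, y⟩, hp, hx, hy⟩
    exact ⟨_, (mem_blowUp hB).2 (Or.inl ⟨x, y, hp, rfl, rfl⟩), shift_lt_shift.2 hx,
      shift_lt_shift.2 hy⟩

theorem above_blowUp_self (hB : IsColouring δ η B) :
    Above (blowUp δ η (c + 1) B) (c + 1) ↔ δ ≤ c ∧ c < η := by
  constructor
  · rintro ⟨⟨x, y⟩, hp, hx, hy⟩
    rw [mem_blowUp hB] at hp
    rcases hp with ⟨x', y', h, rfl, rfl⟩ | ⟨h1, h2, rfl, rfl⟩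
    · have := hB _ h
      simp only [shift] at hx hy this
      split_ifs at hx hy <;> omega
    · exact ⟨h1, h2⟩
  · rintro ⟨h1, h2⟩
    exact ⟨(c, c + 2), (mem_blowUp hB).2 (Or.inr ⟨h1, h2, rfl, rfl⟩), by simp, by simp⟩

/-- No arc ends at the tip c+1 of an ear, as it would cross the ear. So the tip can be deleted, and
the ear itself drops onto the base line. -/
theorem IsTriangulation.exists_blowDown (hB : IsTriangulation δ (η + 1) B) (hc : (c, c + 2) ∈ B) :
    ∃ B', IsTriangulation δ η B' ∧ blowUp δ η (c + 1) B' = B := by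
  have hcol := hB.colouring
  have bc := hcol _ hc
  simp only at bc
  have hno1 : ∀ y, (c + 1, y) ∉ B := by
    intro y h
    have := hcol _ h
    exact hB.noncrossing _ _ _ _ hc h (by omega) (by omega) (by simp only at this; omega)
  have hno2 : ∀ x, (x, c + 1) ∉ B := by
    intro x h
    have := hcol _ h
    exact hB.noncrossing _ _ _ _ h hc (by simp only at this; omega) (by omega) (by omega)
  have key : ∀ x y, IsBlack B (shift (c + 1) x) (shift (c + 1) y) → x < y →
      y = x + 1 ∨ (x + 2 ≤ y ∧ (shift (c + 1) x, shift (c + 1) y) ∈ B) := by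
    intro x y h hxy
    by_cases hy : y = x + 1
    · exact Or.inl hy
    · rcases h with h | h
      · exfalso
        unfold shift at h
        split_ifs at h <;> omega
      · exact Or.inr ⟨by omega, h⟩
  let f : ℕ × ℕ → ℕ × ℕ := fun p => (shift (c + 1) p.1, shift (c + 1) p.2)
  let B' : Finset (ℕ × ℕ) :=
    (B.preimage f (shiftPair_injective _).injOn).filter fun p => p.1 + 2 ≤ p.2
  have hB' : ∀ x y, (x, y) ∈ B' ↔ (shift (c + 1) x, shift (c + 1) y) ∈ B ∧ x + 2 ≤ y := by
    intro x y
    simp [B', f]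
  have hcol' : IsColouring δ η B' := by
    rintro ⟨x, y⟩ h
    rw [hB'] at h
    have := hcol _ h.1
    simp only [shift] at this ⊢
    split_ifs at this <;> omega
  have hT : IsTriangulation δ η B' := by
    refine ⟨hcol', ?_, ?_⟩
    · intro x y x' y' h h' h1 h2 h3
      rw [hB'] at h h'
      exact hB.noncrossing _ _ _ _ h.1 h'.1 (shift_lt_shift.2 h1) (shift_lt_shift.2 h2)
        (shift_lt_shift.2 h3)
    · intro x y h
      rw [hB'] at h
      obtain ⟨z, h1, h2, h3, h4⟩ := hB.split _ _ h.1
      -- Only the ear is split at its tip, and the ear is excluded because after the shift back its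
      -- length is one.
      have hz : z ≠ c + 1 := by
        rintro rfl
        have hx : shift (c + 1) x = c := by
          rcases h3 with h3 | h3
          · omega
          · exact absurd h3 (hno2 _)
        have hy : shift (c + 1) y = c + 2 := by
          rcases h4 with h4 | h4
          · exact h4
          · exact absurd h4 (hno1 _)
        have hx := shift_inj.1 (hx.trans (shift_self c).symm)
        have hy := shift_inj.1 (hy.trans (shift_succ_self c).symm)
        omega
      obtain ⟨w, rfl⟩ := exists_shift hz
      rw [shift_lt_shift] at h1 h2
      refine ⟨w, h1, h2, ?_, ?_⟩
      · rcases key _ _ h3 h1 with h | h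
        · exact Or.inl h
        · exact Or.inr ((hB' _ _).2 ⟨h.2, h.1⟩)
      · rcases key _ _ h4 h2 with h | h
        · exact Or.inl h
        · exact Or.inr ((hB' _ _).2 ⟨h.2, h.1⟩)
  refine ⟨B', hT, ?_⟩
  ext ⟨x, y⟩
  rw [mem_blowUp hcol']
  constructor
  · rintro (⟨x', y', h, rfl, rfl⟩ | ⟨_, _, rfl, rfl⟩)
    · exact ((hB' _ _).1 h).1
    · exact hc
  · intro h
    have b := hcol _ h
    simp only at b
    have hx : x ≠ c + 1 := by rintro rfl; exact hno1 _ h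
    have hy : y ≠ c + 1 := by rintro rfl; exact hno2 _ h
    obtain ⟨u, rfl⟩ := exists_shift hx
    obtain ⟨v, rfl⟩ := exists_shift hy
    by_cases huv : u + 2 ≤ v
    · exact Or.inl ⟨u, v, (hB' _ _).2 ⟨h, huv⟩, rfl, rfl⟩
    · have huc : u = c ∧ v = c + 1 := by
        have b2 := b.2.1
        unfold shift at b2
        split_ifs at b2 <;> omega
      rw [huc.1, huc.2]
      exact Or.inr ⟨by omega, by omega, shift_self _, shift_succ_self _⟩

theorem blowLeft_of_le (h : δ ≤ c) : blowLeft c δ = δ := by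
  unfold blowLeft; split_ifs <;> omega

theorem blowRight_of_le (h : c ≤ η) : blowRight c η = η + 1 := by
  unfold blowRight; split_ifs <;> omega

end CyclicQuotient

/-! ### Combinatorial comparison of two triangulations by removing ears -/

namespace CyclicQuotient

/-- The number `θ_β`. -/
def theta (B : Finset (ℕ × ℕ)) (β : ℕ) : ℕ := if alphaNum B β = 1 then 1 else 0

theorem theta_of_above {B : Finset (ℕ × ℕ)} {β : ℕ} (h : Above B β) : theta B β = 0 :=
  if_neg fun h' => alphaNum_eq_one_iff.1 h' h

theorem theta_of_not_above {B : Finset (ℕ × ℕ)} {β : ℕ} (h : ¬ Above B β) : theta B β = 1 :=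
  if_pos (alphaNum_eq_one_iff.2 h)

theorem theta_le_one (B : Finset (ℕ × ℕ)) (β : ℕ) : theta B β ≤ 1 := by
  unfold theta
  split_ifs <;> omega

variable {δ η c : ℕ} {B : Finset (ℕ × ℕ)}

theorem theta_blowUp (hB : IsColouring δ η B) (β : ℕ) :
    theta (blowUp δ η (c + 1) B) (shift (c + 1) β) = theta B β := by
  by_cases h : Above B β
  · rw [theta_of_above h, theta_of_above ((above_blowUp hB).2 h)]
  · rw [theta_of_not_above h, theta_of_not_above (mt (above_blowUp hB).1 h)]

/-- For these `i` and `j` the polynomial `σ_β^{(ij)}` vanishes on the component of `B`. -/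
def Admissible (m N : ℕ) (B : Finset (ℕ × ℕ)) (β i j : ℕ) : Prop :=
  (¬ Above B β ∧ i ≤ rightCount m N B β ∧ j ≤ leftCount m N B β) ∨
    (Above B β ∧ i + j + 1 ≤ rightCount m N B β + leftCount m N B β)

/-- The factors of λ have indices (2,0) at δ, (2,1) inside and (1,1) at η. If none were admissible,
then reading from right to left B would have an ear at η and then an arc to η+1 from every vertex
down to δ. That arc makes the right count at δ at least two, so (2,0) is admissible after all. -/
theorem exists_admissible_empty_lam {m N : ℕ} (hB : IsTriangulation m N B) (h1 : m ≤ δ)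
    (h2 : δ < η) (h3 : η < N) :
    ∃ β, δ ≤ β ∧ β ≤ η ∧
      Admissible m N B β (rightCount δ η ∅ β + 1) (leftCount δ η ∅ β) := by
  by_contra! hno
  have hbase : ∀ x, m ≤ x → x < N → (x, x + 1) ∈ extended m N B :=
    fun x hx hx' => mem_extended.2 (Or.inr ⟨hx, hx', rfl⟩)
  have hchain : ∀ j β, β + j + 1 = η → δ ≤ β → (β, η + 1) ∈ B := by
    intro j
    induction j with
    | zero =>
      intro β hβ _
      subst hβ
      have hη := hno (β + 1) (by omega) le_rfl
      have hR : 1 ≤ rightCount m N B (β + 1) := one_le_rightCount (by omega) h3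
      have hL : 1 ≤ leftCount m N B (β + 1) := one_le_leftCount (by omega) h3.le
      simp only [Admissible, add_zero, rightCount_last (by simp [IsColouring] : IsColouring δ (β + 1) ∅),
        leftCount_empty h2 le_rfl] at hη
      have hab : Above B (β + 1) := by
        by_contra hab
        exact hη (Or.inl ⟨hab, by omega, by omega⟩)
      have : ¬ (3 ≤ rightCount m N B (β + 1) + leftCount m N B (β + 1)) :=
        fun h => hη (Or.inr ⟨hab, by omega⟩)
      exact hB.ear_of_counts hab (by omega) (by omega)
    | succ j ih =>
      intro β hβ hδ
      have hmem := ih (β + 1) (by omega) (by omega)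
      have hβ' := hno (β + 1) (by omega) (by omega)
      rw [rightCount_empty (by omega) (by omega), leftCount_empty (by omega) (by omega)] at hβ'
      have hL : 1 ≤ leftCount m N B (β + 1) := one_le_leftCount (by omega) (by omega)
      have hR : 2 ≤ rightCount m N B (β + 1) :=
        two_le_rightCount (mem_extended.2 (Or.inl hmem)) (hbase _ (by omega) (by omega)) (by omega)
      have hab : Above B (β + 1) := by
        by_contra hab
        exact hβ' (Or.inl ⟨hab, by omega, by omega⟩)
      have hsum : ¬ (4 ≤ rightCount m N B (β + 1) + leftCount m N B (β + 1)) :=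
        fun h => hβ' (Or.inr ⟨hab, by omega⟩)
      obtain ⟨x, y, hp, hx, hy, hx', hy'⟩ := hB.exists_split_above hab
      have hxe : x = β := by
        rcases hx' with hx' | hx'
        · omega
        · by_contra hne
          have := two_le_leftCount (mem_extended.2 (Or.inl hx'))
            (hbase β (by omega) (by omega)) hne
          omega
      subst hxe
      rcases hy' with rfl | hy'
      · exact (hB.noncrossing _ _ _ _ hp hmem (by omega) (by omega) (by omega)).elim
      -- A second long arc leaving this vertex would push its degree past the bound, so the arc
      -- above must end at η+1.
      · have := hB.colouring _ hy'
        by_contra hne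
        have hye : y ≠ η + 1 := by rintro rfl; exact hne hp
        have := three_le_rightCount (mem_extended.2 (Or.inl hy')) (mem_extended.2 (Or.inl hmem))
          (hbase (x + 1) (by omega) (by omega)) hye (by simp only at this; omega) (by omega)
        omega
  have hmem := hchain (η - δ - 1) δ (by omega) le_rfl
  have hδ := hno δ le_rfl h2.le
  rw [rightCount_empty le_rfl h2, leftCount_first (by simp [IsColouring])] at hδ
  have hR : 2 ≤ rightCount m N B δ :=
    two_le_rightCount (mem_extended.2 (Or.inl hmem)) (hbase _ (by omega) (by omega)) (by omega)
  by_cases hab : Above B δ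
  · have := hB.above_bounds hab
    have hL : 1 ≤ leftCount m N B δ := one_le_leftCount (by omega) (by omega)
    exact hδ (Or.inr ⟨hab, by omega⟩)
  · exact hδ (Or.inl ⟨hab, by omega, by omega⟩)

/-- The mirror image: the indices are (1,1) at δ, (1,2) inside and (0,2) at η, and the fan of arcs
starts at δ-1 and is built from left to right. -/
theorem exists_admissible_empty_rho {m N : ℕ} (hB : IsTriangulation m N B) (h1 : m < δ)
    (h2 : δ < η) (h3 : η ≤ N) :
    ∃ β, δ ≤ β ∧ β ≤ η ∧
      Admissible m N B β (rightCount δ η ∅ β) (leftCount δ η ∅ β + 1) := by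
  by_contra! hno
  have hbase : ∀ x, m ≤ x → x < N → (x, x + 1) ∈ extended m N B :=
    fun x hx hx' => mem_extended.2 (Or.inr ⟨hx, hx', rfl⟩)
  obtain ⟨d, rfl⟩ : ∃ d, δ = d + 1 := ⟨δ - 1, by omega⟩
  have hchain : ∀ j, d + j + 2 ≤ η → (d, d + j + 2) ∈ B := by
    intro j
    induction j with
    | zero =>
      intro _
      have hδ := hno (d + 1) le_rfl h2.le
      have hR : 1 ≤ rightCount m N B (d + 1) := one_le_rightCount (by omega) (by omega)
      have hL : 1 ≤ leftCount m N B (d + 1) := one_le_leftCount (by omega) (by omega)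
      simp only [Admissible, leftCount_first (by simp [IsColouring] : IsColouring (d + 1) η ∅),
        rightCount_empty le_rfl h2] at hδ
      have hab : Above B (d + 1) := by
        by_contra hab
        exact hδ (Or.inl ⟨hab, by omega, by omega⟩)
      have : ¬ (3 ≤ rightCount m N B (d + 1) + leftCount m N B (d + 1)) :=
        fun h => hδ (Or.inr ⟨hab, by omega⟩)
      exact hB.ear_of_counts hab (by omega) (by omega)
    | succ j ih =>
      intro hj
      have hmem := ih (by omega)
      have hβ' := hno (d + j + 2) (by omega) (by omega)
      rw [rightCount_empty (by omega) (by omega), leftCount_empty (by omega) (by omega)] at hβ'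
      have hR : 1 ≤ rightCount m N B (d + j + 2) := one_le_rightCount (by omega) (by omega)
      have hL : 2 ≤ leftCount m N B (d + j + 2) :=
        two_le_leftCount (mem_extended.2 (Or.inl hmem)) (hbase (d + j + 1) (by omega) (by omega))
          (by omega)
      have hab : Above B (d + j + 2) := by
        by_contra hab
        exact hβ' (Or.inl ⟨hab, by omega, by omega⟩)
      have hsum : ¬ (4 ≤ rightCount m N B (d + j + 2) + leftCount m N B (d + j + 2)) :=
        fun h => hβ' (Or.inr ⟨hab, by omega⟩)
      obtain ⟨x, y, hp, hx, hy, hx', hy'⟩ := hB.exists_split_above hab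
      have hye : y = d + j + 3 := by
        rcases hy' with hy' | hy'
        · omega
        · by_contra hne
          have := two_le_rightCount (mem_extended.2 (Or.inl hy'))
            (hbase (d + j + 2) (by omega) (by omega)) hne
          omega
      subst hye
      rcases hx' with hx' | hx'
      · exact (hB.noncrossing _ _ _ _ hmem hp (by omega) (by omega) (by omega)).elim
      · have := hB.colouring _ hx'
        by_contra hne
        have hxe : x ≠ d := by rintro rfl; exact hne hp
        have := three_le_leftCount (mem_extended.2 (Or.inl hx')) (mem_extended.2 (Or.inl hmem))
          (hbase (d + j + 1) (by omega) (by omega)) hxe (by simp only at this; omega) (by omega)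
        omega
  have hmem := hchain (η - d - 2) (by omega)
  rw [show d + (η - d - 2) + 2 = η by omega] at hmem
  have hη := hno η h2.le le_rfl
  rw [leftCount_empty h2 le_rfl, rightCount_last (by simp [IsColouring])] at hη
  have hL : 2 ≤ leftCount m N B η :=
    two_le_leftCount (x := d) (x' := η - 1) (mem_extended.2 (Or.inl hmem))
      (mem_extended.2 (Or.inr (by omega))) (by omega)
  by_cases hab : Above B η
  · have := hB.above_bounds hab
    have hR : 1 ≤ rightCount m N B η := one_le_rightCount (by omega) (by omega)
    exact hη (Or.inr ⟨hab, by omega⟩)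
  · exact hη (Or.inl ⟨hab, by omega, by omega⟩)

theorem counts_of_ear {m N : ℕ} (hB : IsTriangulation m (N + 1) B) (hc : (c, c + 2) ∈ B) :
    rightCount m (N + 1) B (c + 1) = 1 ∧ leftCount m (N + 1) B (c + 1) = 1 := by
  have b := hB.colouring _ hc
  simp only at b
  obtain ⟨B', hB', rfl⟩ := hB.exists_blowDown hc
  have h1 := rightCount_blowUp_self (c := c) hB'.colouring (by omega) (by omega)
  have h2 := leftCount_blowUp_self (c := c) hB'.colouring (by omega) (by omega)
  rw [blowLeft_of_le b.1, blowRight_of_le (by omega)] at h1 h2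
  exact ⟨h1, h2⟩

theorem above_of_ear (hc : (c, c + 2) ∈ B) : Above B (c + 1) :=
  ⟨_, hc, by simp, by simp⟩

/-- Given a component and a generator `λ` or `ρ` of `J'`, some factor of the generator vanishes
on the component. -/
theorem exists_admissible {p q : ℕ} (n : ℕ) : ∀ {m N δ η : ℕ} {B B' : Finset (ℕ × ℕ)},
    IsTriangulation m N B → IsTriangulation δ η B' → η ≤ n → m ≤ δ → δ < η → η ≤ N →
    (p = 1 ∧ q = 0 ∧ η < N ∨ p = 0 ∧ q = 1 ∧ m < δ) →
    ∃ β, δ ≤ β ∧ β ≤ η ∧ Admissible m N B β (rightCount δ η B' β + p * theta B' β)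
      (leftCount δ η B' β + q * theta B' β) := by
  induction n with
  | zero => intros; omega
  | succ n ih =>
    intro m N δ η B B' hB hB' hn h1 h2 h3 hpq
    rcases eq_or_ne B' ∅ with rfl | hne
    · simp only [theta_of_not_above (not_above_empty _)]
      rcases hpq with ⟨rfl, rfl, h4⟩ | ⟨rfl, rfl, h4⟩
      · simpa using exists_admissible_empty_lam hB h1 h2 h4
      · simpa using exists_admissible_empty_rho hB h4 h2 h3
    obtain ⟨c, hc⟩ := hB'.exists_ear hne
    have b' := hB'.colouring _ hc
    simp only at b'
    obtain ⟨η, rfl⟩ : ∃ k, η = k + 1 := ⟨η - 1, by omega⟩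
    obtain ⟨N, rfl⟩ : ∃ k, N = k + 1 := ⟨N - 1, by omega⟩
    -- A common ear is removed from both triangles; this lowers the counts at its two neighbours
    -- equally, so admissibility is preserved. If B has no ear at c+1, the factor there, with
    -- indices (1,1), is admissible itself.
    by_cases hcB : (c, c + 2) ∈ B
    · obtain ⟨B₁, hB₁, rfl⟩ := hB.exists_blowDown hcB
      obtain ⟨B₁', hB₁', rfl⟩ := hB'.exists_blowDown hc
      obtain ⟨β, h4, h5, h6⟩ := ih hB₁ hB₁' (by omega) h1 (by omega) (by omega)
        (by omega)
      refine ⟨shift (c + 1) β, ?_, ?_, ?_⟩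
      · have := (blowLeft_le_shift (c := c)).2 h4
        rwa [blowLeft_of_le b'.1] at this
      · have := (shift_le_blowRight (c := c)).2 h5
        rwa [blowRight_of_le (by omega)] at this
      · have r1 := rightCount_blowUp (c := c) hB₁.colouring (by omega : m ≤ β) (by omega)
        have r2 := leftCount_blowUp (c := c) hB₁.colouring (by omega : m ≤ β) (by omega)
        have r3 := rightCount_blowUp (c := c) hB₁'.colouring h4 h5
        have r4 := leftCount_blowUp (c := c) hB₁'.colouring h4 h5
        rw [blowLeft_of_le (by omega), blowRight_of_le (by omega)] at r1 r2 r3 r4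
        unfold Admissible at h6 ⊢
        rw [r1, r2, r3, r4, theta_blowUp hB₁'.colouring, above_blowUp hB₁.colouring]
        rcases h6 with ⟨h7, h8, h9⟩ | ⟨h7, h8⟩
        · exact Or.inl ⟨h7, by omega, by omega⟩
        · exact Or.inr ⟨h7, by omega⟩
    · refine ⟨c + 1, by omega, by omega, ?_⟩
      obtain ⟨r1, r2⟩ := counts_of_ear hB' hc
      rw [r1, r2, theta_of_above (above_of_ear hc)]
      have hR : 1 ≤ rightCount m (N + 1) B (c + 1) := one_le_rightCount (by omega) (by omega)
      have hL : 1 ≤ leftCount m (N + 1) B (c + 1) := one_le_leftCount (by omega) (by omega)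
      by_cases hab : Above B (c + 1)
      · refine Or.inr ⟨hab, ?_⟩
        by_contra hlt
        exact hcB (hB.ear_of_counts hab (by omega) (by omega))
      · exact Or.inl ⟨hab, by omega, by omega⟩

/-- The tip of an ear of B' has degree two. The hypothesis bounds its degree in B by two as well,
which makes it an ear of B. Removing the ear from both changes degrees equally, so induction
applies. -/
theorem IsTriangulation.eq_of_counts_le (n : ℕ) : ∀ {m N : ℕ} {B B' : Finset (ℕ × ℕ)},
    IsTriangulation m N B → IsTriangulation m N B' → N ≤ n →
    (∀ β, Above B β → Above B' β) →
    (∀ β, Above B' β → rightCount m N B β + leftCount m N B β + theta B β ≤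
      rightCount m N B' β + leftCount m N B' β) → B = B' := by
  have hemp : ∀ {m N : ℕ} {B : Finset (ℕ × ℕ)}, IsTriangulation m N B →
      (∀ β, Above B β → Above ∅ β) → B = ∅ := by
    intro m N B hB h
    by_contra hne
    obtain ⟨c, hc⟩ := hB.exists_ear hne
    exact not_above_empty _ (h _ (above_of_ear hc))
  induction n with
  | zero =>
    intro m N B B' hB hB' hn h1 _
    have : B' = ∅ := by
      by_contra hne
      obtain ⟨c, hc⟩ := hB'.exists_ear hne
      have := hB'.colouring _ hc
      simp only at this
      omega
    subst this
    exact hemp hB h1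
  | succ n ih =>
    intro m N B B' hB hB' hn h1 h2
    rcases eq_or_ne B' ∅ with rfl | hne
    · exact hemp hB h1
    obtain ⟨c, hc⟩ := hB'.exists_ear hne
    have b' := hB'.colouring _ hc
    simp only at b'
    obtain ⟨N, rfl⟩ : ∃ k, N = k + 1 := ⟨N - 1, by omega⟩
    -- Both base edges already use up the degree two, so the vertex cannot be joined to the outer
    -- vertex and must lie below an arc of B.
    have hcB : (c, c + 2) ∈ B := by
      have h3 := h2 _ (above_of_ear hc)
      obtain ⟨r1, r2⟩ := counts_of_ear hB' hc
      rw [r1, r2] at h3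
      have hR : 1 ≤ rightCount m (N + 1) B (c + 1) := one_le_rightCount (by omega) (by omega)
      have hL : 1 ≤ leftCount m (N + 1) B (c + 1) := one_le_leftCount (by omega) (by omega)
      by_cases hab : Above B (c + 1)
      · exact hB.ear_of_counts hab (by omega) (by omega)
      · rw [theta_of_not_above hab] at h3
        omega
    obtain ⟨B₁, hB₁, rfl⟩ := hB.exists_blowDown hcB
    obtain ⟨B₁', hB₁', rfl⟩ := hB'.exists_blowDown hc
    rw [ih hB₁ hB₁' (by omega)]
    · intro β hβ
      exact (above_blowUp hB₁'.colouring).1 (h1 _ ((above_blowUp hB₁.colouring).2 hβ))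
    · intro β hβ
      have b := hB₁'.above_bounds hβ
      have h3 := h2 _ ((above_blowUp hB₁'.colouring).2 hβ)
      have r1 := rightCount_blowUp (c := c) hB₁.colouring (by omega : m ≤ β) (by omega)
      have r2 := leftCount_blowUp (c := c) hB₁.colouring (by omega : m ≤ β) (by omega)
      have r3 := rightCount_blowUp (c := c) hB₁'.colouring (by omega : m ≤ β) (by omega)
      have r4 := leftCount_blowUp (c := c) hB₁'.colouring (by omega : m ≤ β) (by omega)
      rw [blowLeft_of_le (by omega), blowRight_of_le (by omega)] at r1 r2 r3 r4
      rw [r1, r2, r3, r4, theta_blowUp hB₁.colouring] at h3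
      omega

end CyclicQuotient

/-! ### Solutions of the equations of J' in a domain -/

namespace CyclicQuotient

theorem prod_Icc_blow {M : Type*} [CommMonoid M] (c δ η : ℕ) (f : ℕ → M) :
    ∏ β ∈ Finset.Icc (blowLeft c δ) (blowRight c η), f β =
      (if δ ≤ c + 1 ∧ c ≤ η then f (c + 1) else 1) *
        ∏ β ∈ Finset.Icc δ η, f (shift (c + 1) β) := by
  have e : Finset.Icc (blowLeft c δ) (blowRight c η) =
      (if δ ≤ c + 1 ∧ c ≤ η then {c + 1} else ∅) ∪
        (Finset.Icc δ η).image (shift (c + 1)) := by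
    ext x
    simp only [Finset.mem_Icc, Finset.mem_union, Finset.mem_image]
    constructor
    · rintro ⟨h1, h2⟩
      rcases eq_or_ne x (c + 1) with rfl | hx
      · left
        rw [if_pos]
        · simp
        · unfold blowLeft at h1
          unfold blowRight at h2
          split_ifs at h1 h2 <;> omega
      · obtain ⟨y, rfl⟩ := exists_shift hx
        exact Or.inr ⟨y, ⟨blowLeft_le_shift.1 h1, shift_le_blowRight.1 h2⟩, rfl⟩
    · rintro (h1 | ⟨y, ⟨h1, h2⟩, rfl⟩)
      · split_ifs at h1 with h2
        · rw [Finset.mem_singleton] at h1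
          subst h1
          unfold blowLeft blowRight
          split_ifs <;> omega
        · simp at h1
      · exact ⟨blowLeft_le_shift.2 h1, shift_le_blowRight.2 h2⟩
  rw [e, Finset.prod_union, Finset.prod_image]
  · split_ifs <;> simp
  · intro x _ y _ hxy
    exact shift_inj.1 hxy
  · rw [Finset.disjoint_left]
    intro x h1 h2
    split_ifs at h1
    · rw [Finset.mem_singleton] at h1
      subst h1
      obtain ⟨y, _, hy⟩ := Finset.mem_image.1 h2
      exact shift_ne _ _ hy
    · simp at h1

theorem prod_Icc_succ_self {M : Type*} [CommMonoid M] (c : ℕ) (f : ℕ → M) :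
    ∏ β ∈ Finset.Icc c (c + 1), f β = f c * f (c + 1) := by
  rw [Finset.prod_Icc_succ_top (by omega)]
  simp

/-- The data of the remainders `σ_β^{(ij)}`, `m ≤ β ≤ N`, at a point (with values in a domain) where
the equations of `J'` hold. -/
structure VanishingSystem {D : Type*} [CommRing D] (m N : ℕ) (σ : ℕ → ℕ → ℕ → D) (t : ℕ → D) :
    Prop where
  t_first : t m = 0
  t_last : t N = 0
  rel : ∀ β, m ≤ β → β ≤ N → ∀ i j, σ β (i + 1) j - σ β i (j + 1) = t β * σ β (i + 1) (j + 1)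
  one_zero : ∀ β, m ≤ β → β ≤ N → σ β 1 0 = 0
  zero_one : ∀ β, m ≤ β → β ≤ N → σ β 0 1 = 0
  lam : ∀ δ η B, IsTriangulation δ η B → m ≤ δ → δ < η → η < N →
    ∏ β ∈ Finset.Icc δ η, σ β (rightCount δ η B β + theta B β) (leftCount δ η B β) = 0
  rho : ∀ δ η B, IsTriangulation δ η B → m < δ → δ < η → η ≤ N →
    ∏ β ∈ Finset.Icc δ η, σ β (rightCount δ η B β) (leftCount δ η B β + theta B β) = 0

namespace VanishingSystem

variable {D : Type*} [CommRing D] {m N c : ℕ} {σ : ℕ → ℕ → ℕ → D} {t : ℕ → D}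

theorem t_mul (h : VanishingSystem m N σ t) {β : ℕ} (h1 : m ≤ β) (h2 : β ≤ N) :
    t β * σ β 1 1 = 0 := by
  rw [← h.rel β h1 h2 0 0, zero_add, h.one_zero β h1 h2, h.zero_one β h1 h2, sub_zero]

/-- The equations of the component belonging to the coloured triangle `B` hold. -/
def Lies (m N : ℕ) (σ : ℕ → ℕ → ℕ → D) (t : ℕ → D) (B : Finset (ℕ × ℕ)) : Prop :=
  ∀ β, m ≤ β → β ≤ N → (Above B β → t β = 0) ∧
    ∀ i j, i ≤ rightCount m N B β → j ≤ leftCount m N B β → 1 ≤ i + j →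
      i + j + 1 ≤ rightCount m N B β + leftCount m N B β + theta B β → σ β i j = 0

theorem lies_empty (h : VanishingSystem m N σ t)
    (h0 : ∀ β, m < β → β < N → σ β 1 1 = 0) : Lies m N σ t ∅ := by
  intro β h1 h2
  refine ⟨fun hab => absurd hab (not_above_empty _), fun i j hi hj hij _ => ?_⟩
  have hcol : ∀ a b, IsColouring a b ∅ := fun _ _ => by simp [IsColouring]
  have hi1 : i ≤ 1 ∧ (β = N → i = 0) := by
    rcases h2.eq_or_lt with rfl | h2
    · rw [rightCount_last (hcol _ _)] at hi; omega
    · rw [rightCount_empty h1 h2] at hi; omega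
  have hj1 : j ≤ 1 ∧ (β = m → j = 0) := by
    rcases h1.eq_or_lt with rfl | h1
    · rw [leftCount_first (hcol _ _)] at hj; omega
    · rw [leftCount_empty h1 h2] at hj; omega
  obtain ⟨rfl, rfl⟩ | ⟨rfl, rfl⟩ | ⟨rfl, rfl⟩ :
    (i = 1 ∧ j = 0) ∨ (i = 0 ∧ j = 1) ∨ (i = 1 ∧ j = 1) := by omega
  · exact h.one_zero β h1 h2
  · exact h.zero_one β h1 h2
  · exact h0 β (by omega) (by omega)

variable [IsDomain D]

theorem t_eq_zero (h : VanishingSystem m N σ t) (h1 : m ≤ c) (h2 : c < N)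
    (hc : σ (c + 1) 1 1 ≠ 0) : t (c + 1) = 0 :=
  (mul_eq_zero.1 (h.t_mul (by omega) (by omega))).resolve_right hc

theorem two_zero_eq (h : VanishingSystem m N σ t) (h1 : m ≤ c) (h2 : c < N)
    (hc : σ (c + 1) 1 1 ≠ 0) : σ (c + 1) 2 0 = σ (c + 1) 1 1 := by
  have := h.rel (c + 1) (by omega) (by omega) 1 0
  rwa [h.t_eq_zero h1 h2 hc, zero_mul, sub_eq_zero] at this

theorem zero_two_eq (h : VanishingSystem m N σ t) (h1 : m ≤ c) (h2 : c < N)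
    (hc : σ (c + 1) 1 1 ≠ 0) : σ (c + 1) 0 2 = σ (c + 1) 1 1 := by
  have := h.rel (c + 1) (by omega) (by omega) 0 1
  rw [h.t_eq_zero h1 h2 hc, zero_mul, sub_eq_zero] at this
  exact this.symm

/-- For the triangle on c, c+1 the generators are λ = σ_c^(20) σ_{c+1}^(11) and ρ = σ_c^(11)
σ_{c+1}^(02). The second factors are equal and nonzero. -/
theorem left_neighbour (h : VanishingSystem m N σ t) (h1 : m ≤ c) (h2 : c + 1 < N)
    (hc : σ (c + 1) 1 1 ≠ 0) : σ c 2 0 = 0 ∧ σ c 1 1 = 0 := by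
  have hcol : ∀ a b, IsColouring a b ∅ := fun _ _ => by simp [IsColouring]
  have e1 : σ c 2 0 = 0 := by
    have := h.lam c (c + 1) ∅ (isTriangulation_empty _ _) h1 (by omega) h2
    rw [prod_Icc_succ_self, theta_of_not_above (not_above_empty _),
      theta_of_not_above (not_above_empty _), rightCount_empty le_rfl (by omega),
      rightCount_last (hcol _ _), leftCount_empty (by omega) le_rfl, leftCount_first (hcol _ _)] at this
    exact (mul_eq_zero.1 this).resolve_right hc
  refine ⟨e1, ?_⟩
  -- At the first vertex ρ is not available, but there t = 0 and hence σ^(20) = σ^(11).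
  rcases h1.eq_or_lt with rfl | h1
  · have := h.rel m le_rfl (by omega) 1 0
    rwa [h.t_first, zero_mul, e1, zero_sub, neg_eq_zero] at this
  · have := h.rho c (c + 1) ∅ (isTriangulation_empty _ _) h1 (by omega) h2.le
    rw [prod_Icc_succ_self, theta_of_not_above (not_above_empty _),
      theta_of_not_above (not_above_empty _), rightCount_empty le_rfl (by omega),
      rightCount_last (hcol _ _), leftCount_empty (by omega) le_rfl, leftCount_first (hcol _ _)] at this
    exact (mul_eq_zero.1 this).resolve_right (by rwa [h.zero_two_eq h1.le (by omega) hc])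

theorem right_neighbour (h : VanishingSystem m N σ t) (h1 : m ≤ c) (h2 : c + 1 < N)
    (hc : σ (c + 1) 1 1 ≠ 0) : σ (c + 2) 0 2 = 0 ∧ σ (c + 2) 1 1 = 0 := by
  have hcol : ∀ a b, IsColouring a b ∅ := fun _ _ => by simp [IsColouring]
  have e1 : σ (c + 2) 0 2 = 0 := by
    have := h.rho (c + 1) (c + 2) ∅ (isTriangulation_empty _ _) (by omega) (by omega) h2
    rw [prod_Icc_succ_self, theta_of_not_above (not_above_empty _),
      theta_of_not_above (not_above_empty _), rightCount_empty le_rfl (by omega),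
      rightCount_last (hcol _ _), leftCount_empty (by omega) le_rfl, leftCount_first (hcol _ _)] at this
    exact (mul_eq_zero.1 this).resolve_left hc
  refine ⟨e1, ?_⟩
  rcases (Nat.succ_le_of_lt h2).eq_or_lt with rfl | h3
  · have := h.rel (c + 2) (by omega) le_rfl 0 1
    have ht : t (c + 2) = 0 := h.t_last
    rwa [ht, zero_mul, e1, sub_zero] at this
  · have := h.lam (c + 1) (c + 2) ∅ (isTriangulation_empty _ _) (by omega) (by omega) h3
    rw [prod_Icc_succ_self, theta_of_not_above (not_above_empty _),
      theta_of_not_above (not_above_empty _), rightCount_empty le_rfl (by omega),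
      rightCount_last (hcol _ _), leftCount_empty (by omega) le_rfl, leftCount_first (hcol _ _)] at this
    exact (mul_eq_zero.1 this).resolve_left (by
      change σ (c + 1) 2 0 ≠ 0
      rwa [h.two_zero_eq h1 (by omega) hc])

/-- The position `c + 1`, where `σ^{(11)}` does not vanish, can be removed. -/
theorem blowDown (h : VanishingSystem m (N + 1) σ t) (h1 : m ≤ c) (h2 : c < N)
    (hc : σ (c + 1) 1 1 ≠ 0) :
    VanishingSystem m N (fun β i j => σ (shift (c + 1) β) (i + if β = c then 1 else 0)
      (j + if β = c + 1 then 1 else 0)) (fun β => t (shift (c + 1) β)) := by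
  have hge : ∀ {β}, m ≤ β → m ≤ shift (c + 1) β := by
    intro β hβ; unfold shift; split_ifs <;> omega
  have hle : ∀ {β}, β ≤ N → shift (c + 1) β ≤ N + 1 := by
    intro β hβ; unfold shift; split_ifs <;> omega
  have hl := h.left_neighbour h1 (by omega) hc
  have hr := h.right_neighbour h1 (by omega) hc
  have hin : ∀ {δ η}, δ < η → m ≤ δ → m ≤ blowLeft c δ ∧ blowLeft c δ < blowRight c η := by
    intro δ η h3 h4
    unfold blowLeft blowRight; split_ifs <;> omega
  -- The factor at the removed vertex has indices (1,1) in the interior of the blown-up triangle,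
  -- and (2,0), (1,1) or (0,2) at an end; all of these equal σ^(11). A triangle that starts at c+1
  -- or ends at c is enlarged by the removed vertex, so that its blow-up has the base edge
  -- accounting for the raised index.
  have hvals : ∀ {δ η B}, IsTriangulation δ η B → δ < η → δ ≤ c + 1 → c ≤ η →
      ∀ p q, p + q = 1 → σ (c + 1)
        (rightCount (blowLeft c δ) (blowRight c η) (blowUp δ η (c + 1) B) (c + 1) +
          p * theta (blowUp δ η (c + 1) B) (c + 1))
        (leftCount (blowLeft c δ) (blowRight c η) (blowUp δ η (c + 1) B) (c + 1) +
          q * theta (blowUp δ η (c + 1) B) (c + 1)) ≠ 0 := by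
    intro δ η B hB h3 h4 h5 p q hpq
    have h20 := h.two_zero_eq h1 (by omega) hc
    have h02 := h.zero_two_eq h1 (by omega) hc
    have hT := isTriangulation_blowUp hB c
    have hab := above_blowUp_self (c := c) hB.colouring
    have hpq' : (p = 0 ∧ q = 1) ∨ (p = 1 ∧ q = 0) := by omega
    rcases h4.eq_or_lt with rfl | h4
    · rw [rightCount_blowUp_self hB.colouring le_rfl h3.le, theta_of_not_above (by rw [hab]; omega)]
      have : blowLeft c (c + 1) = c + 1 := by simp [blowLeft]
      rw [this] at hT ⊢
      rw [leftCount_first hT.colouring]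
      rcases hpq' with ⟨rfl, rfl⟩ | ⟨rfl, rfl⟩
      · exact hc
      · change σ (c + 1) 2 0 ≠ 0
        rwa [h20]
    · rw [leftCount_blowUp_self hB.colouring (by omega) h5]
      rcases h5.eq_or_lt with rfl | h5
      · rw [theta_of_not_above (by rw [hab]; omega)]
        have : blowRight c c = c + 1 := by simp [blowRight]
        rw [this] at hT ⊢
        rw [rightCount_last hT.colouring]
        rcases hpq' with ⟨rfl, rfl⟩ | ⟨rfl, rfl⟩
        · change σ (c + 1) 0 2 ≠ 0
          rwa [h02]
        · exact hc
      · rw [rightCount_blowUp_self hB.colouring (by omega) h5, theta_of_above (by rw [hab]; omega)]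
        exact hc
  refine ⟨?_, ?_, ?_, ?_, ?_, ?_, ?_⟩
  · have : shift (c + 1) m = m := by unfold shift; split_ifs <;> omega
    simp only [this, h.t_first]
  · have : shift (c + 1) N = N + 1 := by unfold shift; split_ifs <;> omega
    simp only [this, h.t_last]
  · intro β h3 h4 i j
    have := h.rel _ (hge h3) (hle h4) (i + if β = c then 1 else 0) (j + if β = c + 1 then 1 else 0)
    simp only [add_right_comm _ 1]
    exact this
  · intro β h3 h4
    by_cases hβ : β = c
    · subst hβ
      simpa [shift_self] using hl.1
    · by_cases hβ' : β = c + 1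
      · subst hβ'
        simpa [shift_succ_self] using hr.2
      · simpa [hβ, hβ'] using h.one_zero _ (hge h3) (hle h4)
  · intro β h3 h4
    by_cases hβ : β = c
    · subst hβ
      simpa [shift_self] using hl.2
    · by_cases hβ' : β = c + 1
      · subst hβ'
        simpa [shift_succ_self] using hr.1
      · simpa [hβ, hβ'] using h.zero_one _ (hge h3) (hle h4)
  · intro δ η B hB h3 h4 h5
    -- The equation of the blow-up is the wanted equation times the factor at c+1, or times 1 if
    -- that vertex is not involved.
    have := h.lam _ _ _ (isTriangulation_blowUp hB c) (hin h4 h3).1 (hin h4 h3).2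
      (by unfold blowRight; split_ifs <;> omega)
    rw [prod_Icc_blow c] at this
    replace this := (mul_eq_zero.1 this).resolve_left (by
      split_ifs with hcd
      · have := hvals hB h4 hcd.1 hcd.2 1 0 rfl
        simpa using this
      · exact one_ne_zero)
    rw [← this]
    refine Finset.prod_congr rfl fun β hβ => ?_
    rw [Finset.mem_Icc] at hβ
    rw [rightCount_blowUp hB.colouring hβ.1 hβ.2, leftCount_blowUp hB.colouring hβ.1 hβ.2,
      theta_blowUp hB.colouring, add_right_comm]
  · intro δ η B hB h3 h4 h5
    have := h.rho _ _ _ (isTriangulation_blowUp hB c)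
      (by unfold blowLeft; split_ifs <;> omega) (hin h4 h3.le).2
      (by unfold blowRight; split_ifs <;> omega)
    rw [prod_Icc_blow c] at this
    replace this := (mul_eq_zero.1 this).resolve_left (by
      split_ifs with hcd
      · have := hvals hB h4 hcd.1 hcd.2 0 1 rfl
        simpa using this
      · exact one_ne_zero)
    rw [← this]
    refine Finset.prod_congr rfl fun β hβ => ?_
    rw [Finset.mem_Icc] at hβ
    rw [rightCount_blowUp hB.colouring hβ.1 hβ.2, leftCount_blowUp hB.colouring hβ.1 hβ.2,
      theta_blowUp hB.colouring]
    simp only [add_right_comm]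

/-- Away from the neighbours of the new vertex nothing changes. At c only remainders with positive
first index are supplied by the smaller system, at c+2 only those with positive second index; the
missing border cases come from the relation between adjacent remainders. -/
theorem lies_blowUp (h : VanishingSystem m (N + 1) σ t) (h1 : m ≤ c) (h2 : c < N)
    (hc : σ (c + 1) 1 1 ≠ 0) {B : Finset (ℕ × ℕ)} (hB : IsTriangulation m N B)
    (hL : Lies m N (fun β i j => σ (shift (c + 1) β) (i + if β = c then 1 else 0)
      (j + if β = c + 1 then 1 else 0)) (fun β => t (shift (c + 1) β)) B) :
    Lies m (N + 1) σ t (blowUp m N (c + 1) B) := by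
  intro β h3 h4
  rcases eq_or_ne β (c + 1) with rfl | hβ
  · refine ⟨fun _ => h.t_eq_zero h1 (by omega) hc, fun i j hi hj hij hk => ?_⟩
    have r1 := rightCount_blowUp_self (c := c) hB.colouring (by omega) (by omega)
    have r2 := leftCount_blowUp_self (c := c) hB.colouring (by omega) (by omega)
    rw [blowLeft_of_le h1, blowRight_of_le (by omega)] at r1 r2
    rw [r1, r2, theta_of_above ((above_blowUp_self hB.colouring).2 ⟨h1, h2⟩)] at hk
    obtain ⟨rfl, rfl⟩ | ⟨rfl, rfl⟩ : (i = 1 ∧ j = 0) ∨ (i = 0 ∧ j = 1) := by omega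
    · exact h.one_zero _ h3 h4
    · exact h.zero_one _ h3 h4
  · obtain ⟨b, rfl⟩ := exists_shift hβ
    have hb1 : m ≤ b := by
      rw [← blowLeft_of_le h1] at h3
      exact blowLeft_le_shift.1 h3
    have hb2 : b ≤ N := by
      rw [← blowRight_of_le h2.le] at h4
      exact shift_le_blowRight.1 h4
    have r1 := rightCount_blowUp (c := c) hB.colouring hb1 hb2
    have r2 := leftCount_blowUp (c := c) hB.colouring hb1 hb2
    rw [blowLeft_of_le h1, blowRight_of_le (by omega)] at r1 r2
    rw [above_blowUp hB.colouring, r1, r2, theta_blowUp hB.colouring]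
    obtain ⟨l1, l2⟩ := hL b hb1 hb2
    replace l1 : Above B b → t (shift (c + 1) b) = 0 := l1
    refine ⟨l1, fun i j hi hj hij hk => ?_⟩
    have z10 := h.one_zero _ h3 h4
    have z01 := h.zero_one _ h3 h4
    have rel := h.rel _ h3 h4
    rcases eq_or_ne b c with rfl | hbc
    · have hne : b ≠ b + 1 := by omega
      simp only [if_true, if_neg hne, add_zero] at l2 hi hj hk
      rcases i with _ | i
      · rcases j with _ | _ | j
        · omega
        · exact z01
        · have e1 := l2 0 (j + 1) (by omega) (by omega) (by omega) (by omega)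
          -- Below an arc the factor t vanishes; otherwise the degree bound is slack and the σ
          -- factor vanishes.
          have e2 : t (shift (b + 1) b) * σ (shift (b + 1) b) 1 (j + 2) = 0 := by
            by_cases hab : Above B b
            · rw [l1 hab, zero_mul]
            · rw [theta_of_not_above hab] at l2
              have := l2 0 (j + 2) (by omega) (by omega) (by omega) (by omega)
              simp only [zero_add] at this
              rw [this, mul_zero]
          have e3 := rel 0 (j + 1)
          simp only [zero_add] at e1 e3
          rw [e1, e2, zero_sub, neg_eq_zero] at e3
          exact e3
      · rcases Nat.eq_zero_or_pos (i + j) with h0 | h0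
        · obtain ⟨rfl, rfl⟩ : i = 0 ∧ j = 0 := by omega
          exact z10
        · exact l2 i j (by omega) hj h0 (by omega)
    · rcases eq_or_ne b (c + 1) with rfl | hbc'
      · simp only [if_true, if_neg hbc, add_zero] at l2 hi hj hk
        rcases j with _ | j
        · rcases i with _ | _ | i
          · omega
          · exact z10
          · have e1 := l2 (i + 1) 0 (by omega) (by omega) (by omega) (by omega)
            have e2 : t (shift (c + 1) (c + 1)) * σ (shift (c + 1) (c + 1)) (i + 2) 1 = 0 := by
              by_cases hab : Above B (c + 1)
              · rw [l1 hab, zero_mul]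
              · rw [theta_of_not_above hab] at l2
                have := l2 (i + 2) 0 (by omega) (by omega) (by omega) (by omega)
                simp only [zero_add] at this
                rw [this, mul_zero]
            have e3 := rel (i + 1) 0
            simp only [zero_add] at e1 e3
            rw [e1, e2, sub_zero] at e3
            exact e3
        · rcases Nat.eq_zero_or_pos (i + j) with h0 | h0
          · obtain ⟨rfl, rfl⟩ : i = 0 ∧ j = 0 := by omega
            exact z01
          · exact l2 i j hi (by omega) h0 (by omega)
      · simp only [if_neg hbc, if_neg hbc', add_zero] at l2 hi hj hk
        exact l2 i j hi hj hij hk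

/-- Induction on the right end N, deleting any vertex at which σ^(11) is nonzero and blowing up
again at the end. -/
theorem exists_lies (n : ℕ) : ∀ {m N : ℕ} {σ : ℕ → ℕ → ℕ → D} {t : ℕ → D},
    VanishingSystem m N σ t → N ≤ n → ∃ B, IsTriangulation m N B ∧ Lies m N σ t B := by
  induction n with
  | zero =>
    intro m N σ t h hn
    exact ⟨∅, isTriangulation_empty _ _, h.lies_empty (by intros; omega)⟩
  | succ n ih =>
    intro m N σ t h hn
    by_cases h0 : ∀ β, m < β → β < N → σ β 1 1 = 0
    · exact ⟨∅, isTriangulation_empty _ _, h.lies_empty h0⟩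
    · push Not at h0
      obtain ⟨β, h1, h2, h3⟩ := h0
      obtain ⟨c, rfl⟩ : ∃ c, β = c + 1 := ⟨β - 1, by omega⟩
      obtain ⟨N, rfl⟩ : ∃ k, N = k + 1 := ⟨N - 1, by omega⟩
      obtain ⟨B, hB, hL⟩ := ih (h.blowDown (by omega) (by omega) h3) (by omega)
      refine ⟨_, ?_, h.lies_blowUp (by omega) (by omega) h3 hB hL⟩
      have := isTriangulation_blowUp hB c
      rwa [blowLeft_of_le (by omega), blowRight_of_le (by omega)] at this

end VanishingSystem

end CyclicQuotient

namespace CyclicQuotient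

/-! ## Iterated division with remainder by two linear polynomials -/

section Division

variable {K : Type*} [CommRing K]

theorem X_sub_C_mul_divByMonic_add (f : K[X]) (a : K) :
    (X - C a) * (f /ₘ (X - C a)) + C (f.eval a) = f := by
  rw [← modByMonic_X_sub_C_eq_C_eval, add_comm, modByMonic_add_div]

theorem divByMonic_X_sub_C_unique {f q : K[X]} {a c : K} (h : f = (X - C a) * q + C c) :
    f /ₘ (X - C a) = q := by
  nontriviality K
  refine (div_modByMonic_unique q (C c) (monic_X_sub_C a) ⟨?_, ?_⟩).1
  · rw [h, add_comm]
  · rw [degree_X_sub_C]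
    exact lt_of_le_of_lt degree_C_le (by decide)

theorem divByMonic_comm_aux (f : K[X]) (l r : K) :
    f /ₘ (X - C r) = (X - C l) * (f /ₘ (X - C l) /ₘ (X - C r)) + C ((f /ₘ (X - C l)).eval r) := by
  have h1 := X_sub_C_mul_divByMonic_add f l
  have h2 := X_sub_C_mul_divByMonic_add (f /ₘ (X - C l)) r
  refine divByMonic_X_sub_C_unique (c := (f /ₘ (X - C l)).eval r * (r - l) + f.eval l) ?_
  conv_lhs => rw [← h1, ← h2]
  simp only [C_add, C_mul, C_sub]
  ring

theorem divByMonic_comm (f : K[X]) (l r : K) :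
    f /ₘ (X - C l) /ₘ (X - C r) = f /ₘ (X - C r) /ₘ (X - C l) :=
  (divByMonic_X_sub_C_unique (divByMonic_comm_aux f l r)).symm

theorem eval_divByMonic_comm (f : K[X]) (l r : K) :
    (f /ₘ (X - C r)).eval l = (f /ₘ (X - C l)).eval r := by
  rw [divByMonic_comm_aux f l r]
  simp

/-- The quotient after `i` divisions by `X - l` and `j` divisions by `X - r`. -/
noncomputable def iterDiv (f : K[X]) (l r : K) (i j : ℕ) : K[X] :=
  (fun f => f /ₘ (X - C r))^[j] ((fun f => f /ₘ (X - C l))^[i] f)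

/-- The remainders of the iterated divisions. -/
noncomputable def iterRem (f : K[X]) (l r : K) : ℕ → ℕ → K
  | i + 1, j => (iterDiv f l r i j).eval l
  | 0, j + 1 => (iterDiv f l r 0 j).eval r
  | 0, 0 => 0

variable (f : K[X]) (l r : K)

theorem iterDiv_zero : iterDiv f l r 0 0 = f := rfl

theorem iterDiv_succ_right (i j : ℕ) :
    iterDiv f l r i (j + 1) = iterDiv f l r i j /ₘ (X - C r) :=
  Function.iterate_succ_apply' _ _ _

theorem iterDiv_succ_left (i j : ℕ) :
    iterDiv f l r (i + 1) j = iterDiv f l r i j /ₘ (X - C l) := by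
  unfold iterDiv
  rw [Function.iterate_succ_apply']
  have h : Function.Commute (fun f : K[X] => f /ₘ (X - C r)) (fun f => f /ₘ (X - C l)) :=
    fun f => divByMonic_comm f l r
  exact (h.iterate_left j).eq _

theorem iterRem_succ_left (i j : ℕ) : iterRem f l r (i + 1) j = (iterDiv f l r i j).eval l := rfl

theorem iterRem_succ_right (i j : ℕ) :
    iterRem f l r i (j + 1) = (iterDiv f l r i j).eval r := by
  cases i with
  | zero => rfl
  | succ i =>
    rw [iterRem_succ_left, iterDiv_succ_right, iterDiv_succ_left, eval_divByMonic_comm]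

/-- Evaluate the same quotient at l and at r; the difference is l - r times a value of the next
quotient. -/
theorem iterRem_sub (i j : ℕ) :
    iterRem f l r (i + 1) j - iterRem f l r i (j + 1) = (l - r) * iterRem f l r (i + 1) (j + 1) := by
  rw [iterRem_succ_left, iterRem_succ_right, iterRem_succ_left, iterDiv_succ_right]
  conv_lhs => rw [← X_sub_C_mul_divByMonic_add (iterDiv f l r i j) r]
  simp

theorem iterDiv_mul_left (i j : ℕ) :
    (X - C l) * iterDiv f l r (i + 1) j + C (iterRem f l r (i + 1) j) = iterDiv f l r i j := by
  rw [iterDiv_succ_left, iterRem_succ_left, X_sub_C_mul_divByMonic_add]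

theorem iterDiv_mul_right (i j : ℕ) :
    (X - C r) * iterDiv f l r i (j + 1) + C (iterRem f l r i (j + 1)) = iterDiv f l r i j := by
  rw [iterDiv_succ_right, iterRem_succ_right, X_sub_C_mul_divByMonic_add]

theorem map_iterDiv {K' : Type*} [CommRing K'] (φ : K →+* K') (i j : ℕ) :
    (iterDiv f l r i j).map φ = iterDiv (f.map φ) (φ l) (φ r) i j := by
  induction j with
  | zero =>
    induction i with
    | zero => rfl
    | succ i ih =>
      rw [iterDiv_succ_left, iterDiv_succ_left, map_divByMonic φ (monic_X_sub_C _), ih]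
      simp
  | succ j ih =>
    rw [iterDiv_succ_right, iterDiv_succ_right, map_divByMonic φ (monic_X_sub_C _), ih]
    simp

theorem map_iterRem {K' : Type*} [CommRing K'] (φ : K →+* K') (i j : ℕ) :
    φ (iterRem f l r i j) = iterRem (f.map φ) (φ l) (φ r) i j := by
  rcases i with _ | i
  · rcases j with _ | j
    · exact map_zero φ
    · rw [iterRem_succ_right, iterRem_succ_right, ← map_iterDiv, eval_map_apply]
  · rw [iterRem_succ_left, iterRem_succ_left, ← map_iterDiv, eval_map_apply]

theorem iterDiv_mul_pow (i j : ℕ) :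
    iterDiv ((X - C l) ^ i * (X - C r) ^ j * f) l r i j = f := by
  unfold iterDiv
  have h1 : ∀ (a : K) (n : ℕ) (g : K[X]),
      (fun f => f /ₘ (X - C a))^[n] ((X - C a) ^ n * g) = g := by
    intro a n
    induction n with
    | zero => intro g; simp
    | succ n ih =>
      intro g
      rw [Function.iterate_succ_apply, pow_succ', mul_assoc,
        mul_divByMonic_cancel_left _ (monic_X_sub_C a), ih]
  rw [mul_assoc, h1, h1]

theorem iterRem_eq_zero {p q i j : ℕ} (hi : i ≤ p) (hj : j ≤ q) :
    iterRem ((X - C l) ^ p * (X - C r) ^ q * f) l r i j = 0 := by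
  rcases i with _ | i
  · rcases j with _ | j
    · rfl
    · obtain ⟨q, rfl⟩ := Nat.exists_eq_add_of_le hj
      rw [iterRem_succ_right, show (X - C l) ^ p * (X - C r) ^ (j + 1 + q) * f =
        (X - C l) ^ 0 * (X - C r) ^ j * ((X - C r) * ((X - C l) ^ p * (X - C r) ^ q * f)) by ring,
        iterDiv_mul_pow]
      simp
  · obtain ⟨p, rfl⟩ := Nat.exists_eq_add_of_le hi
    obtain ⟨q, rfl⟩ := Nat.exists_eq_add_of_le hj
    rw [iterRem_succ_left, show (X - C l) ^ (i + 1 + p) * (X - C r) ^ (j + q) * f =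
        (X - C l) ^ i * (X - C r) ^ j * ((X - C l) * ((X - C l) ^ p * (X - C r) ^ q * f)) by ring,
        iterDiv_mul_pow]
    simp

/-- It suffices that the remainders vanish along one lattice path from (0,0) to (p,q): first all
divisions by X - l, then all by X - r. -/
theorem eq_mul_iterDiv {p q : ℕ} (h1 : ∀ i, 1 ≤ i → i ≤ p → iterRem f l r i 0 = 0)
    (h2 : ∀ j, 1 ≤ j → j ≤ q → iterRem f l r p j = 0) :
    f = (X - C l) ^ p * (X - C r) ^ q * iterDiv f l r p q := by
  have h3 : f = (X - C l) ^ p * iterDiv f l r p 0 := by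
    clear h2
    induction p with
    | zero => simp [iterDiv_zero]
    | succ p ih =>
      have h4 := iterDiv_mul_left f l r p 0
      rw [h1 (p + 1) (by omega) le_rfl, C_0, add_zero] at h4
      rw [pow_succ, mul_assoc, h4]
      exact ih fun i hi hi' => h1 i hi (by omega)
  have h4 : iterDiv f l r p 0 = (X - C r) ^ q * iterDiv f l r p q := by
    induction q with
    | zero => simp
    | succ q ih =>
      have h5 := iterDiv_mul_right f l r p q
      rw [h2 (q + 1) (by omega) le_rfl, C_0, add_zero] at h5
      rw [pow_succ, mul_assoc, h5]
      exact ih fun j hj hj' => h2 j hj (by omega)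
  rw [mul_assoc, ← h4]
  exact h3

theorem iterRem_diag (i j : ℕ) : iterRem f l l i j = iterRem f l l (i + j) 0 := by
  induction j generalizing i with
  | zero => rfl
  | succ j ih =>
    have h := iterRem_sub f l l i j
    rw [sub_self, zero_mul, sub_eq_zero] at h
    rw [← h, ih, Nat.add_right_comm]
    rfl

theorem monic_iterDiv [Nontrivial K] {d p q : ℕ} (hf : f.Monic) (hd : f.natDegree = d)
    (h : p + q ≤ d) :
    (iterDiv f l r p q).Monic ∧ (iterDiv f l r p q).natDegree = d - (p + q) := by
  have key : ∀ (g : K[X]) (a : K), g.Monic → 1 ≤ g.natDegree →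
      (g /ₘ (X - C a)).Monic ∧ (g /ₘ (X - C a)).natDegree = g.natDegree - 1 := by
    intro g a hg hg'
    refine ⟨?_, ?_⟩
    · rw [Monic, leadingCoeff_divByMonic_of_monic (monic_X_sub_C a), hg.leadingCoeff]
      rw [degree_X_sub_C, degree_eq_natDegree hg.ne_zero]
      exact_mod_cast hg'
    · rw [natDegree_divByMonic _ (monic_X_sub_C a), natDegree_X_sub_C]
  induction q with
  | zero =>
    induction p with
    | zero => exact ⟨hf, hd⟩
    | succ p ih =>
      obtain ⟨i1, i2⟩ := ih (by omega)
      rw [iterDiv_succ_left]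
      obtain ⟨k1, k2⟩ := key _ l i1 (by omega)
      exact ⟨k1, by omega⟩
  | succ q ih =>
    obtain ⟨i1, i2⟩ := ih (by omega)
    rw [iterDiv_succ_right]
    obtain ⟨k1, k2⟩ := key _ r i1 (by omega)
    exact ⟨k1, by omega⟩

/-- A monic polynomial, with its coefficients in decreasing order. -/
theorem sum_coeff_reflect {d : ℕ} (hf : f.natDegree = d) :
    ∑ ν ∈ Finset.range (d + 1), C (f.coeff (d - ν)) * X ^ (d - ν) = f := by
  conv_rhs => rw [f.as_sum_range_C_mul_X_pow, hf, ← Finset.sum_range_reflect]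
  rfl

end Division

/-! ## The remainders `σ_ε^{(ij)}` -/

variable (e : ℕ) (a : ℕ → ℕ)

theorem sigma_eq (ε i j : ℕ) :
    sigma e a ε i j = iterRem (ZPoly e a ε) 0 (-tPar e a ε) i j := by
  rcases i with _ | i
  · rcases j with _ | j <;> rfl
  · rfl

theorem sigma_sub (ε i j : ℕ) :
    sigma e a ε (i + 1) j - sigma e a ε i (j + 1) = tPar e a ε * sigma e a ε (i + 1) (j + 1) := by
  simp only [sigma_eq, iterRem_sub, zero_sub, neg_neg]

theorem sigma_zero_one (ε : ℕ) : sigma e a ε 0 1 = 0 := by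
  rw [sigma_eq, iterRem_succ_right, iterDiv_zero]
  simp [ZPoly, RPoly, rPar]

/-- This is why the generators (l - r)σ^(11) of J' say that σ^(10) vanishes. -/
theorem sigma_one_zero (ε : ℕ) : sigma e a ε 1 0 = tPar e a ε * sigma e a ε 1 1 := by
  rw [← zero_add 1, ← sigma_sub, zero_add, sigma_zero_one, sub_zero]

theorem tPar_eq_zero {ε : ℕ} (h : ¬ (2 < ε ∧ ε + 1 < e)) : tPar e a ε = 0 := dif_neg h

end CyclicQuotient

namespace CyclicQuotient

/-! ## Parametrisation of the components -/

theorem natDegree_sum_reflect {K : Type*} [CommRing K] [Nontrivial K] (s : ℕ → K) (h : s 0 = 1)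
    (d : ℕ) :
    (∑ ν ∈ Finset.range (d + 1), C (s ν) * X ^ (d - ν)).Monic ∧
    (∑ ν ∈ Finset.range (d + 1), C (s ν) * X ^ (d - ν)).natDegree = d ∧
    ∀ ν ≤ d, (∑ ν ∈ Finset.range (d + 1), C (s ν) * X ^ (d - ν)).coeff (d - ν) = s ν := by
  have hc : ∀ ν ≤ d, (∑ ν ∈ Finset.range (d + 1), C (s ν) * X ^ (d - ν)).coeff (d - ν) = s ν := by
    intro ν hν
    rw [finsetSum_coeff, Finset.sum_eq_single ν]
    · simp
    · intro b hb hne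
      rw [Finset.mem_range] at hb
      rw [coeff_C_mul, coeff_X_pow, if_neg (by omega), mul_zero]
    · intro hn
      exact absurd (Finset.mem_range.2 (by omega)) hn
  have hle : (∑ ν ∈ Finset.range (d + 1), C (s ν) * X ^ (d - ν)).natDegree ≤ d := by
    refine natDegree_sum_le_of_forall_le _ _ fun ν _ => ?_
    exact (natDegree_C_mul_X_pow_le _ _).trans (by omega)
  have h0 := hc 0 (by omega)
  rw [Nat.sub_zero, h] at h0
  refine ⟨monic_of_natDegree_le_of_coeff_eq_one d hle h0, le_antisymm hle ?_, hc⟩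
  exact le_natDegree_of_ne_zero (by rw [h0]; exact one_ne_zero)

noncomputable section

variable (e : ℕ) (a : ℕ → ℕ) (B : Finset (ℕ × ℕ))

/-- The exponent of `L_ε` in `Z_ε^{(00)}` on the component of `B`. -/
def leftExp (ε : ℕ) : ℕ := rightCount 2 (e - 1) B ε + theta B ε - 1

/-- The exponent of `R_ε` in `Z_ε^{(00)}` on the component of `B`. -/
def rightExp (ε : ℕ) : ℕ := leftCount 2 (e - 1) B ε

/-- The restriction of `t_ε` to the component of `B`. -/
def tComp (ε : ℕ) : BaseRing e a := if alphaNum B ε = 1 then tPar e a ε else 0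

/-- The cofactor of `L_ε ^ p R_ε ^ q` in `Z_ε^{(00)}` on the component of `B`. -/
def cofactor (ε : ℕ) : (BaseRing e a)[X] :=
  ∑ ν ∈ Finset.range (a ε - (leftExp e B ε + rightExp e B ε) + 1),
    C (sPar e a ε ν) * X ^ (a ε - (leftExp e B ε + rightExp e B ε) - ν)

/-- The restriction of `Z_ε^{(00)}` to the component of `B`. -/
def ZComp (ε : ℕ) : (BaseRing e a)[X] :=
  (X - C 0) ^ leftExp e B ε * (X - C (-tComp e a B ε)) ^ rightExp e B ε * cofactor e a B ε

/-- The restriction of the second factor of `Z_ε^{(00)}` to the component of `B`. -/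
def SComp (ε : ℕ) : (BaseRing e a)[X] := ZComp e a B ε /ₘ (X - C (-tComp e a B ε))

/-- The parametrisation of the component of `B` by an affine space, as ring homomorphism. -/
def paramMap : BaseRing e a →ₐ[ℂ] BaseRing e a :=
  MvPolynomial.aeval fun
    | Coord.t ε _ => tComp e a B ε
    | Coord.s ε ν _ _ => (SComp e a B ε).coeff (a ε - 1 - ν)

/-- The second factor of `Z_ε^{(00)}`. -/
def SPoly (ε : ℕ) : (BaseRing e a)[X] :=
  ∑ ν ∈ Finset.range (a ε), C (sPar e a ε ν) * X ^ (a ε - 1 - ν)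

variable {e a B}

theorem ZPoly_eq (ε : ℕ) : ZPoly e a ε = (X - C (-tPar e a ε)) * SPoly e a ε := rfl

theorem sPar_zero (ε : ℕ) : sPar e a ε 0 = 1 := if_pos rfl

theorem tComp_of_above {ε : ℕ} (h : Above B ε) : tComp e a B ε = 0 :=
  if_neg fun h' => alphaNum_eq_one_iff.1 h' h

theorem tComp_of_not_above {ε : ℕ} (h : ¬ Above B ε) : tComp e a B ε = tPar e a ε :=
  if_pos (alphaNum_eq_one_iff.2 h)


/-- Below an arc, L and R coincide on the component and there is one factor fewer than arcs; it is
taken off on the L side, where the right count is positive. The subtraction in `leftExp` is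
therefore never truncated. The right exponent can be zero only at ε = 2, where t = 0. -/
theorem exp_facts (he : 4 ≤ e) (hB : IsTriangulation 2 (e - 1) B) {ε : ℕ} (h2 : 2 ≤ ε)
    (hε : ε < e) :
    leftExp e B ε + rightExp e B ε = kNum 2 (e - 1) B ε ∧
    leftExp e B ε + rightExp e B ε + 1 =
      rightCount 2 (e - 1) B ε + leftCount 2 (e - 1) B ε + theta B ε ∧
    leftExp e B ε ≤ rightCount 2 (e - 1) B ε ∧ 1 ≤ leftExp e B ε + rightExp e B ε ∧
    (¬ Above B ε → leftExp e B ε = rightCount 2 (e - 1) B ε) ∧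
    (rightExp e B ε = 0 → tComp e a B ε = 0 ∧ 1 ≤ leftExp e B ε) := by
  rw [kNum_eq hB.colouring]
  have hR : ε < e - 1 → 1 ≤ rightCount 2 (e - 1) B ε := fun h => one_le_rightCount h2 h
  have hL : 2 < ε → 1 ≤ leftCount 2 (e - 1) B ε := fun h => one_le_leftCount h (by omega)
  unfold leftExp rightExp
  by_cases hab : Above B ε
  · have := hB.above_bounds hab
    rw [theta_of_above hab, if_neg fun h' => alphaNum_eq_one_iff.1 h' hab]
    refine ⟨by omega, by omega, by omega, by omega, fun h => absurd hab h, fun h => ?_⟩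
    omega
  · rw [theta_of_not_above hab, if_pos (alphaNum_eq_one_iff.2 hab)]
    refine ⟨by omega, by omega, by omega, by omega, fun _ => by omega, fun h => ?_⟩
    have h3 : ε = 2 := by omega
    refine ⟨?_, by omega⟩
    rw [tComp_of_not_above hab, tPar_eq_zero e a (by omega)]

theorem cofactor_facts (ε : ℕ) :
    (cofactor e a B ε).Monic ∧
    (cofactor e a B ε).natDegree = a ε - (leftExp e B ε + rightExp e B ε) ∧
    ∀ ν ≤ a ε - (leftExp e B ε + rightExp e B ε),
      (cofactor e a B ε).coeff (a ε - (leftExp e B ε + rightExp e B ε) - ν) = sPar e a ε ν :=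
  natDegree_sum_reflect (sPar e a ε) (sPar_zero ε) _

theorem SPoly_facts (h : 1 ≤ a ε) :
    (SPoly e a ε).Monic ∧ (SPoly e a ε).natDegree = a ε - 1 ∧
    ∀ ν ≤ a ε - 1, (SPoly e a ε).coeff (a ε - 1 - ν) = sPar e a ε ν := by
  have := natDegree_sum_reflect (sPar e a ε) (sPar_zero ε) (a ε - 1)
  rwa [Nat.sub_add_cancel h] at this

theorem ZComp_facts {ε : ℕ} (hk : leftExp e B ε + rightExp e B ε ≤ a ε) :
    (ZComp e a B ε).Monic ∧ (ZComp e a B ε).natDegree = a ε := by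
  obtain ⟨h1, h2, _⟩ := cofactor_facts (e := e) (a := a) (B := B) ε
  have m1 : ((X - C 0 : (BaseRing e a)[X]) ^ leftExp e B ε).Monic := (monic_X_sub_C _).pow _
  have m2 : ((X - C (-tComp e a B ε)) ^ rightExp e B ε).Monic := (monic_X_sub_C _).pow _
  refine ⟨(m1.mul m2).mul h1, ?_⟩
  unfold ZComp
  rw [(m1.mul m2).natDegree_mul h1, m1.natDegree_mul m2, (monic_X_sub_C _).natDegree_pow,
    (monic_X_sub_C _).natDegree_pow, natDegree_X_sub_C, natDegree_X_sub_C, h2]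
  omega

/-- The coordinates s are coefficients of the cofactor of z + t in Z, so the parametrised Z must
keep that factor. When no R is present, t = 0 and a factor L takes its place. -/
theorem mul_SComp (he : 4 ≤ e) (hB : IsTriangulation 2 (e - 1) B) {ε : ℕ} (h2 : 2 ≤ ε)
    (hε : ε < e) : (X - C (-tComp e a B ε)) * SComp e a B ε = ZComp e a B ε := by
  have h : ∃ G, ZComp e a B ε = (X - C (-tComp e a B ε)) * G := by
    obtain ⟨_, _, _, _, _, h3⟩ := exp_facts (a := a) he hB h2 hε
    unfold ZComp
    rcases hq : rightExp e B ε with _ | q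
    · obtain ⟨h4, h5⟩ := h3 hq
      obtain ⟨p, hp⟩ := Nat.exists_eq_add_of_le h5
      rw [h4, hp, neg_zero]
      exact ⟨_, by rw [pow_add, pow_one, mul_assoc, mul_assoc]⟩
    · rw [pow_succ']
      exact ⟨(X - C 0) ^ leftExp e B ε * (X - C (-tComp e a B ε)) ^ q * cofactor e a B ε, by ring⟩
  obtain ⟨G, hG⟩ := h
  unfold SComp
  rw [hG, mul_divByMonic_cancel_left _ (monic_X_sub_C _)]

theorem SComp_facts (he : 4 ≤ e) (hB : IsTriangulation 2 (e - 1) B) {ε : ℕ} (h2 : 2 ≤ ε)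
    (hε : ε < e) (hk : leftExp e B ε + rightExp e B ε ≤ a ε) :
    (SComp e a B ε).Monic ∧ (SComp e a B ε).natDegree = a ε - 1 := by
  obtain ⟨h3, h4⟩ := ZComp_facts hk
  have h5 := mul_SComp (a := a) he hB h2 hε
  have h6 : (SComp e a B ε).Monic := by
    rw [← h5] at h3
    exact (monic_X_sub_C _).of_mul_monic_left h3
  refine ⟨h6, ?_⟩
  rw [← h5, (monic_X_sub_C _).natDegree_mul h6, natDegree_X_sub_C] at h4
  omega

theorem paramMap_tPar (ε : ℕ) : paramMap e a B (tPar e a ε) = tComp e a B ε := by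
  by_cases h : 2 < ε ∧ ε + 1 < e
  · conv_lhs => rw [tPar, dif_pos h]
    simp [paramMap]
  · unfold tComp
    rw [tPar_eq_zero e a h, map_zero, ite_self]

theorem paramMap_sPar (he : 4 ≤ e) (hB : IsTriangulation 2 (e - 1) B) {ε : ℕ} (h2 : 2 ≤ ε)
    (hε : ε < e) (hk : leftExp e B ε + rightExp e B ε ≤ a ε) {ν : ℕ} (hν : ν < a ε) :
    paramMap e a B (sPar e a ε ν) = (SComp e a B ε).coeff (a ε - 1 - ν) := by
  rcases Nat.eq_zero_or_pos ν with rfl | h0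
  · obtain ⟨h3, h4⟩ := SComp_facts he hB h2 hε hk
    rw [sPar_zero, map_one, Nat.sub_zero, ← h4]
    exact h3.coeff_natDegree.symm
  · unfold sPar
    rw [if_neg (by omega), dif_pos ⟨⟨h2, hε⟩, h0, hν⟩]
    simp [paramMap]

theorem map_ZPoly (he : 4 ≤ e) (hB : IsTriangulation 2 (e - 1) B) {ε : ℕ} (h2 : 2 ≤ ε)
    (hε : ε < e) (hk : leftExp e B ε + rightExp e B ε ≤ a ε) :
    (ZPoly e a ε).map (paramMap e a B : BaseRing e a →+* BaseRing e a) = ZComp e a B ε := by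
  obtain ⟨_, _, _, h5, _⟩ := exp_facts (a := a) he hB h2 hε
  rw [ZPoly_eq, ← mul_SComp he hB h2 hε, Polynomial.map_mul]
  congr 1
  · simp [paramMap_tPar]
  · obtain ⟨_, h4⟩ := SComp_facts he hB h2 hε hk
    rw [← sum_coeff_reflect _ h4, SPoly, Polynomial.map_sum, Nat.sub_add_cancel (by omega)]
    refine Finset.sum_congr rfl fun ν hν => ?_
    rw [Finset.mem_range] at hν
    rw [Polynomial.map_mul, Polynomial.map_pow, map_X, map_C, RingHom.coe_coe,
      paramMap_sPar he hB h2 hε hk hν]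

theorem paramMap_sigma (he : 4 ≤ e) (hB : IsTriangulation 2 (e - 1) B) {ε : ℕ} (h2 : 2 ≤ ε)
    (hε : ε < e) (hk : leftExp e B ε + rightExp e B ε ≤ a ε) (i j : ℕ) :
    paramMap e a B (sigma e a ε i j) = iterRem (ZComp e a B ε) 0 (-tComp e a B ε) i j := by
  rw [sigma_eq, ← map_ZPoly he hB h2 hε hk, ← paramMap_tPar]
  have := map_iterRem (ZPoly e a ε) 0 (-tPar e a ε) (paramMap e a B : BaseRing e a →+* BaseRing e a) i j
  simpa using this

theorem paramMap_sigma_eq_zero (he : 4 ≤ e) (hB : IsTriangulation 2 (e - 1) B) {ε : ℕ} (h2 : 2 ≤ ε)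
    (hε : ε < e) (hk : leftExp e B ε + rightExp e B ε ≤ a ε) {i j : ℕ}
    (hi : i ≤ rightCount 2 (e - 1) B ε) (hj : j ≤ leftCount 2 (e - 1) B ε)
    (hij : i + j ≤ leftExp e B ε + rightExp e B ε) :
    paramMap e a B (sigma e a ε i j) = 0 := by
  rw [paramMap_sigma he hB h2 hε hk]
  obtain ⟨_, _, _, _, h5, _⟩ := exp_facts (a := a) he hB h2 hε
  by_cases hab : Above B ε
  · unfold ZComp
    rw [tComp_of_above hab, neg_zero, iterRem_diag, ← pow_add]
    have := iterRem_eq_zero (cofactor e a B ε) (0 : BaseRing e a) 0 (q := 0) hij le_rfl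
    simpa using this
  · exact iterRem_eq_zero _ _ _ (by rw [h5 hab]; exact hi) hj

/-- With t = 0 the component has Z = z^k times the cofactor, so the first remainder past k is the
constant term of the cofactor: a free variable, or 1 if k = a. -/
theorem paramMap_sigma_ne_zero (he : 4 ≤ e) (hB : IsTriangulation 2 (e - 1) B) {ε : ℕ} (h2 : 2 ≤ ε)
    (hε : ε < e) (hk : leftExp e B ε + rightExp e B ε ≤ a ε) (hab : Above B ε) {i j : ℕ}
    (hij : i + j = leftExp e B ε + rightExp e B ε + 1) :
    paramMap e a B (sigma e a ε i j) ≠ 0 := by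
  rw [paramMap_sigma he hB h2 hε hk]
  obtain ⟨_, _, _, h4, _⟩ := exp_facts (a := a) he hB h2 hε
  unfold ZComp
  rw [tComp_of_above hab, neg_zero, iterRem_diag, ← pow_add, hij, iterRem_succ_left]
  have := iterDiv_mul_pow (cofactor e a B ε) (0 : BaseRing e a) 0 (leftExp e B ε + rightExp e B ε) 0
  rw [pow_zero, mul_one] at this
  rw [this, ← coeff_zero_eq_eval_zero]
  have h6 := (cofactor_facts (e := e) (a := a) (B := B) ε).2.2 _ le_rfl
  rw [Nat.sub_self] at h6
  rw [h6]
  unfold sPar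
  split_ifs with h7 h8
  · exact one_ne_zero
  · exact MvPolynomial.X_ne_zero _
  · exact absurd ⟨⟨h2, hε⟩, by omega, by omega⟩ h8

theorem sigma_mem_componentIdeal (he : 4 ≤ e) (hB : IsTriangulation 2 (e - 1) B) {ε : ℕ}
    (h2 : 2 ≤ ε) (hε : ε < e) {i j : ℕ} (hi : i ≤ rightCount 2 (e - 1) B ε)
    (hj : j ≤ leftCount 2 (e - 1) B ε) (hij : i + j ≤ leftExp e B ε + rightExp e B ε) :
    sigma e a ε i j ∈ componentIdeal e a B := by
  rcases Nat.eq_zero_or_pos (i + j) with h0 | h0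
  · obtain ⟨rfl, rfl⟩ : i = 0 ∧ j = 0 := by omega
    exact zero_mem _
  · rw [(exp_facts (a := a) he hB h2 hε).1] at hij
    exact Ideal.subset_span (Or.inr ⟨ε, i, j, h2, hε, h0, hij, hi, hj, rfl⟩)

theorem tPar_mem_componentIdeal (hB : IsTriangulation 2 (e - 1) B) {ε : ℕ} (hab : Above B ε) :
    tPar e a ε ∈ componentIdeal e a B := by
  have := hB.above_bounds hab
  exact Ideal.subset_span (Or.inl ⟨ε, by omega, by omega, one_lt_alphaNum_iff.2 hab, rfl⟩)

theorem componentIdeal_le_ker (he : 4 ≤ e) (hB : IsTriangulation 2 (e - 1) B)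
    (hk : ∀ ε, 2 ≤ ε → ε < e → leftExp e B ε + rightExp e B ε ≤ a ε) :
    componentIdeal e a B ≤ RingHom.ker (paramMap e a B) := by
  unfold componentIdeal
  rw [Ideal.span_le]
  rintro f (⟨ε, h2, hε, hab, rfl⟩ | ⟨ε, i, j, h2, hε, _, hij, hi, hj, rfl⟩)
  · rw [SetLike.mem_coe, RingHom.mem_ker, paramMap_tPar, tComp_of_above (one_lt_alphaNum_iff.1 hab)]
  · rw [← (exp_facts (a := a) he hB h2 hε).1] at hij
    exact paramMap_sigma_eq_zero he hB h2 hε (hk ε h2 hε) hi hj hij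

/-- A section of the parametrisation, modulo the ideal of the component. -/
def coparamMap (e : ℕ) (a : ℕ → ℕ) (B : Finset (ℕ × ℕ)) :
    BaseRing e a →ₐ[ℂ] BaseRing e a ⧸ componentIdeal e a B :=
  MvPolynomial.aeval fun
    | Coord.t ε _ => Ideal.Quotient.mk _ (tPar e a ε)
    | Coord.s ε ν _ _ => Ideal.Quotient.mk _ ((ZDiv e a ε (leftExp e B ε) (rightExp e B ε)).coeff
        (a ε - (leftExp e B ε + rightExp e B ε) - ν))

theorem coparamMap_tComp (hB : IsTriangulation 2 (e - 1) B) (ε : ℕ) :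
    coparamMap e a B (tComp e a B ε) = Ideal.Quotient.mk _ (tPar e a ε) := by
  by_cases hab : Above B ε
  · rw [tComp_of_above hab, map_zero]
    exact (Ideal.Quotient.eq_zero_iff_mem.2 (tPar_mem_componentIdeal hB hab)).symm
  · rw [tComp_of_not_above hab]
    by_cases h : 2 < ε ∧ ε + 1 < e
    · conv_lhs => rw [tPar, dif_pos h]
      simp [coparamMap]
    · rw [tPar_eq_zero e a h, map_zero, map_zero]

theorem map_cofactor (he : 4 ≤ e) (hB : IsTriangulation 2 (e - 1) B) {ε : ℕ}
    (h2 : 2 ≤ ε) (hε : ε < e) (hk : leftExp e B ε + rightExp e B ε ≤ a ε) :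
    (cofactor e a B ε).map (coparamMap e a B : BaseRing e a →+* _) =
      (ZDiv e a ε (leftExp e B ε) (rightExp e B ε)).map
        (Ideal.Quotient.mk (componentIdeal e a B)) := by
  obtain ⟨_, _, _, h4, _⟩ := exp_facts (a := a) he hB h2 hε
  have hZ : (ZPoly e a ε).Monic ∧ (ZPoly e a ε).natDegree = a ε := by
    obtain ⟨s1, s2, _⟩ := SPoly_facts (e := e) (by omega : 1 ≤ a ε)
    rw [ZPoly_eq]
    refine ⟨(monic_X_sub_C _).mul s1, ?_⟩
    rw [(monic_X_sub_C _).natDegree_mul s1, natDegree_X_sub_C, s2]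
    omega
  obtain ⟨d1, d2⟩ : (ZDiv e a ε (leftExp e B ε) (rightExp e B ε)).Monic ∧
      (ZDiv e a ε (leftExp e B ε) (rightExp e B ε)).natDegree =
        a ε - (leftExp e B ε + rightExp e B ε) :=
    monic_iterDiv (ZPoly e a ε) 0 (-tPar e a ε) hZ.1 hZ.2 hk
  rw [← sum_coeff_reflect _ d2, cofactor, Polynomial.map_sum, Polynomial.map_sum]
  refine Finset.sum_congr rfl fun ν hν => ?_
  rw [Finset.mem_range] at hν
  rw [Polynomial.map_mul, Polynomial.map_mul, Polynomial.map_pow, Polynomial.map_pow, map_X, map_X,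
    map_C, map_C, RingHom.coe_coe]
  congr 2
  rcases Nat.eq_zero_or_pos ν with rfl | h0
  · rw [sPar_zero, map_one, Nat.sub_zero, ← map_one (Ideal.Quotient.mk _), ← d1.coeff_natDegree]
    exact congrArg _ (congrArg _ d2)
  · unfold sPar
    rw [if_neg (by omega), dif_pos ⟨⟨h2, hε⟩, h0, by omega⟩]
    simp [coparamMap]

/-- Modulo the component ideal the remainders along the path to (p,q) vanish, so Z factors as in the
parametrisation, with the iterated quotient as cofactor. -/
theorem map_mk_ZPoly (he : 4 ≤ e) (hB : IsTriangulation 2 (e - 1) B) {ε : ℕ}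
    (h2 : 2 ≤ ε) (hε : ε < e) (hk : leftExp e B ε + rightExp e B ε ≤ a ε) :
    (ZPoly e a ε).map (Ideal.Quotient.mk (componentIdeal e a B)) =
      (ZComp e a B ε).map (coparamMap e a B : BaseRing e a →+* _) := by
  obtain ⟨_, _, h3, _⟩ := exp_facts (a := a) he hB h2 hε
  have hrem : ∀ i j, i ≤ rightCount 2 (e - 1) B ε → j ≤ leftCount 2 (e - 1) B ε →
      i + j ≤ leftExp e B ε + rightExp e B ε →
      iterRem ((ZPoly e a ε).map (Ideal.Quotient.mk (componentIdeal e a B)))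
        (Ideal.Quotient.mk _ 0) (Ideal.Quotient.mk _ (-tPar e a ε)) i j = 0 := by
    intro i j hi hj hij
    rw [← map_iterRem, ← sigma_eq]
    exact Ideal.Quotient.eq_zero_iff_mem.2 (sigma_mem_componentIdeal he hB h2 hε hi hj hij)
  have h := eq_mul_iterDiv ((ZPoly e a ε).map (Ideal.Quotient.mk (componentIdeal e a B)))
    (Ideal.Quotient.mk _ 0) (Ideal.Quotient.mk _ (-tPar e a ε))
    (p := leftExp e B ε) (q := rightExp e B ε)
    (fun i _ hi => hrem i 0 (by omega) (by omega) (by omega))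
    (fun j _ hj => hrem _ j h3 hj (by omega))
  rw [← map_iterDiv] at h
  rw [h, ZComp, Polynomial.map_mul, map_cofactor he hB h2 hε hk, Polynomial.map_mul,
    Polynomial.map_pow, Polynomial.map_pow]
  congr 2
  · simp
  · simp [coparamMap_tComp hB]

theorem map_mk_SPoly (he : 4 ≤ e) (hB : IsTriangulation 2 (e - 1) B) {ε : ℕ}
    (h2 : 2 ≤ ε) (hε : ε < e) (hk : leftExp e B ε + rightExp e B ε ≤ a ε) :
    (SPoly e a ε).map (Ideal.Quotient.mk (componentIdeal e a B)) =
      (SComp e a B ε).map (coparamMap e a B : BaseRing e a →+* _) := by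
  have h := map_mk_ZPoly he hB h2 hε hk
  rw [ZPoly_eq, ← mul_SComp he hB h2 hε, Polynomial.map_mul, Polynomial.map_mul] at h
  have h4 : (X - C (-tComp e a B ε)).map (coparamMap e a B : BaseRing e a →+* _) =
      (X - C (-tPar e a ε)).map (Ideal.Quotient.mk (componentIdeal e a B)) := by
    simp [coparamMap_tComp hB]
  rw [h4] at h
  -- The quotient ring is not yet known to be a domain, so the common factor is cancelled because it
  -- is monic.
  exact ((monic_X_sub_C _).map _).isRegular.left h

theorem coparamMap_comp_paramMap (he : 4 ≤ e) (hB : IsTriangulation 2 (e - 1) B)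
    (hk : ∀ ε, 2 ≤ ε → ε < e → leftExp e B ε + rightExp e B ε ≤ a ε) :
    (coparamMap e a B).comp (paramMap e a B) = Ideal.Quotient.mkₐ ℂ (componentIdeal e a B) := by
  refine MvPolynomial.algHom_ext fun x => ?_
  rw [AlgHom.comp_apply, Ideal.Quotient.mkₐ_eq_mk]
  rcases x with ⟨ε, h⟩ | ⟨ε, ν, h, hν⟩
  · have h1 : (MvPolynomial.X (Coord.t ε h) : BaseRing e a) = tPar e a ε := by
      rw [tPar, dif_pos h]
    rw [h1, paramMap_tPar, coparamMap_tComp hB]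
  · have h1 : (MvPolynomial.X (Coord.s ε ν h hν) : BaseRing e a) = sPar e a ε ν := by
      rw [sPar, if_neg (by omega), dif_pos ⟨h, hν⟩]
    rw [h1, paramMap_sPar he hB h.1 h.2 (hk ε h.1 h.2) hν.2]
    have h3 := congrArg (fun f => f.coeff (a ε - 1 - ν)) (map_mk_SPoly he hB h.1 h.2 (hk ε h.1 h.2))
    simp only [coeff_map] at h3
    rw [(SPoly_facts (by omega)).2.2 ν (by omega)] at h3
    exact h3.symm

/-- The quotient map factors through the parametrisation by `coparamMap`, so whatever the
parametrisation kills is zero in the quotient. -/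
theorem componentIdeal_eq_ker (he : 4 ≤ e) (hB : IsTriangulation 2 (e - 1) B)
    (hk : ∀ ε, 2 ≤ ε → ε < e → leftExp e B ε + rightExp e B ε ≤ a ε) :
    componentIdeal e a B = RingHom.ker (paramMap e a B) := by
  refine le_antisymm (componentIdeal_le_ker he hB hk) fun f hf => ?_
  rw [RingHom.mem_ker] at hf
  have h := congrArg (fun g => g f) (coparamMap_comp_paramMap he hB hk)
  simp only [AlgHom.comp_apply, hf, map_zero] at h
  exact Ideal.Quotient.eq_zero_iff_mem.1 h.symm

theorem componentIdeal_isPrime (he : 4 ≤ e) (hB : IsTriangulation 2 (e - 1) B)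
    (hk : ∀ ε, 2 ≤ ε → ε < e → leftExp e B ε + rightExp e B ε ≤ a ε) :
    (componentIdeal e a B).IsPrime := by
  rw [componentIdeal_eq_ker he hB hk]
  exact RingHom.ker_isPrime _

end

end CyclicQuotient

namespace CyclicQuotient

/-! ## Counting sparse coloured triangles -/

theorem IsTriangulation.restrict {δ ε : ℕ} {B : Finset (ℕ × ℕ)} (hB : IsTriangulation δ ε B)
    (α β : ℕ) : IsTriangulation α β (B.filter fun p => α ≤ p.1 ∧ p.2 ≤ β) := by
  refine ⟨?_, ?_, ?_⟩
  · intro p hp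
    rw [Finset.mem_filter] at hp
    exact ⟨hp.2.1, (hB.colouring p hp.1).2.1, hp.2.2⟩
  · intro x y x' y' h h'
    exact hB.noncrossing x y x' y' (Finset.mem_filter.1 h).1 (Finset.mem_filter.1 h').1
  · intro x y h
    rw [Finset.mem_filter] at h
    simp only at h
    obtain ⟨z, h1, h2, h3, h4⟩ := hB.split x y h.1
    refine ⟨z, h1, h2, h3.imp id fun h3 => ?_, h4.imp id fun h4 => ?_⟩
    · exact Finset.mem_filter.2 ⟨h3, h.2.1, by simp only; omega⟩
    · exact Finset.mem_filter.2 ⟨h4, by simp only; omega, h.2.2⟩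

theorem IsTriangulation.glue {δ z ε : ℕ} {B B' : Finset (ℕ × ℕ)} (hB : IsTriangulation δ z B)
    (hB' : IsTriangulation z ε B') (h1 : δ ≤ z) (h2 : z ≤ ε) : IsTriangulation δ ε (B ∪ B') := by
  refine ⟨?_, ?_, ?_⟩
  · intro p hp
    rcases Finset.mem_union.1 hp with hp | hp
    · have := hB.colouring p hp; omega
    · have := hB'.colouring p hp; omega
  · intro x y x' y' h h' h3 h4 h5
    rcases Finset.mem_union.1 h with h | h <;> rcases Finset.mem_union.1 h' with h' | h'
    · exact hB.noncrossing _ _ _ _ h h' h3 h4 h5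
    · have := hB.colouring _ h
      have := hB'.colouring _ h'
      simp only at *
      omega
    · have := hB'.colouring _ h
      have := hB.colouring _ h'
      simp only at *
      omega
    · exact hB'.noncrossing _ _ _ _ h h' h3 h4 h5
  · intro x y h
    rcases Finset.mem_union.1 h with h | h
    · obtain ⟨w, h3, h4, h5, h6⟩ := hB.split _ _ h
      exact ⟨w, h3, h4, h5.imp id (Finset.mem_union_left _), h6.imp id (Finset.mem_union_left _)⟩
    · obtain ⟨w, h3, h4, h5, h6⟩ := hB'.split _ _ h
      exact ⟨w, h3, h4, h5.imp id (Finset.mem_union_right _), h6.imp id (Finset.mem_union_right _)⟩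

theorem IsTriangulation.insert_vertex {δ ε z : ℕ} {B : Finset (ℕ × ℕ)} (hB : IsTriangulation δ ε B)
    (h1 : δ < z) (h2 : z < ε) (h3 : IsBlack B δ z) (h4 : IsBlack B z ε) :
    IsTriangulation δ ε (insert (δ, ε) B) := by
  refine ⟨?_, ?_, ?_⟩
  · intro p hp
    rcases Finset.mem_insert.1 hp with rfl | hp
    · simp only; omega
    · exact hB.colouring p hp
  · intro x y x' y' h h' h5 h6 h7
    have hb : ∀ {x y}, (x, y) ∈ insert (δ, ε) B → δ ≤ x ∧ y ≤ ε := by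
      intro x y h
      rcases Finset.mem_insert.1 h with h | h
      · simp only [Prod.mk.injEq] at h; omega
      · have := hB.colouring _ h; exact ⟨this.1, this.2.2⟩
    have b := hb h
    have b' := hb h'
    rcases Finset.mem_insert.1 h with h | h
    · simp only [Prod.mk.injEq] at h; omega
    rcases Finset.mem_insert.1 h' with h' | h'
    · simp only [Prod.mk.injEq] at h'; omega
    exact hB.noncrossing _ _ _ _ h h' h5 h6 h7
  · intro x y h
    rcases Finset.mem_insert.1 h with h | h
    · simp only [Prod.mk.injEq] at h
      obtain ⟨rfl, rfl⟩ := h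
      exact ⟨z, h1, h2, h3.imp id Finset.mem_insert_of_mem, h4.imp id Finset.mem_insert_of_mem⟩
    · obtain ⟨w, h3, h4, h5, h6⟩ := hB.split _ _ h
      exact ⟨w, h3, h4, h5.imp id Finset.mem_insert_of_mem, h6.imp id Finset.mem_insert_of_mem⟩

/-- If no dot crosses the line `l_z`, the triangle is glued from two smaller ones. -/
theorem eq_union_filter {B : Finset (ℕ × ℕ)} {δ z ε : ℕ}
    (h : ∀ p ∈ B, δ ≤ p.1 ∧ p.2 ≤ ε ∧ (p.2 ≤ z ∨ z ≤ p.1)) :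
    (B.filter fun p => δ ≤ p.1 ∧ p.2 ≤ z) ∪ (B.filter fun p => z ≤ p.1 ∧ p.2 ≤ ε) = B := by
  ext p
  simp only [Finset.mem_union, Finset.mem_filter]
  constructor
  · rintro (h | h) <;> exact h.1
  · intro hp
    obtain ⟨h1, h2, h3 | h3⟩ := h p hp
    · exact Or.inl ⟨hp, h1, h3⟩
    · exact Or.inr ⟨hp, h3, h2⟩

theorem glue_left_eq {δ z ε : ℕ} {T B B' : Finset (ℕ × ℕ)} (hB : IsColouring δ z B)
    (hB' : IsColouring z ε B') (hT : ∀ p ∈ T, p.1 = δ ∧ z < p.2) :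
    ((T ∪ (B ∪ B')).filter fun p => δ ≤ p.1 ∧ p.2 ≤ z) = B := by
  ext p
  simp only [Finset.mem_union, Finset.mem_filter]
  constructor
  · rintro ⟨h | h | h, h1, h2⟩
    · have := hT p h; omega
    · exact h
    · have := hB' p h; omega
  · intro h
    have := hB p h
    exact ⟨Or.inr (Or.inl h), this.1, this.2.2⟩

theorem glue_right_eq {δ z ε : ℕ} {T B B' : Finset (ℕ × ℕ)} (h1 : δ < z) (hB : IsColouring δ z B)
    (hB' : IsColouring z ε B') (hT : ∀ p ∈ T, p.1 = δ ∧ z < p.2) :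
    ((T ∪ (B ∪ B')).filter fun p => z ≤ p.1) = B' := by
  ext p
  simp only [Finset.mem_union, Finset.mem_filter]
  constructor
  · rintro ⟨h | h | h, h1⟩
    · have := hT p h; omega
    · have := hB p h; omega
    · exact h
  · intro h
    have := hB' p h
    exact ⟨Or.inr (Or.inr h), this.1⟩

/-- Makes the cut point recoverable from the glued triangle: the arc from δ to z' can only belong to
the left part of the other decomposition. Applied in both directions it gives z = z'. -/
theorem glue_cut_le {δ z z' ε : ℕ} {T B₁ B₂ B₁' B₂' : Finset (ℕ × ℕ)} (h1 : δ < z)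
    (hB₁ : IsColouring δ z B₁) (hB₂ : IsColouring z ε B₂)
    (hb : IsBlack B₁' δ z') (hT : ∀ p ∈ T, p.1 = δ ∧ z' < p.2)
    (h : T ∪ (B₁ ∪ B₂) = T ∪ (B₁' ∪ B₂')) : z' ≤ z := by
  rcases hb with rfl | hb
  · omega
  have hm : (δ, z') ∈ T ∪ (B₁ ∪ B₂) := by
    rw [h]
    exact Finset.mem_union_right _ (Finset.mem_union_left _ hb)
  simp only [Finset.mem_union] at hm
  rcases hm with hm | hm | hm
  · have := hT _ hm; simp only at this; omega
  · exact (hB₁ _ hm).2.2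
  · have := hB₂ _ hm; simp only at this; omega

open Classical in
/-- The sparse coloured triangles with vertex `(δ, ε)`. -/
noncomputable def triangulations (δ ε : ℕ) : Finset (Finset (ℕ × ℕ)) :=
  (Finset.Icc δ ε ×ˢ Finset.Icc δ ε).powerset.filter (IsTriangulation δ ε)

open Classical in
/-- The sparse coloured triangles with vertex `(δ, ε)` black. -/
noncomputable def fullTriangulations (δ ε : ℕ) : Finset (Finset (ℕ × ℕ)) :=
  (triangulations δ ε).filter (IsBlack · δ ε)

theorem mem_triangulations {δ ε : ℕ} {B : Finset (ℕ × ℕ)} :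
    B ∈ triangulations δ ε ↔ IsTriangulation δ ε B := by
  simp only [triangulations, Finset.mem_filter]
  rw [and_iff_right_iff_imp, Finset.mem_powerset]
  intro h p hp
  have := h.colouring p hp
  simp only [Finset.mem_product, Finset.mem_Icc]
  omega

theorem mem_fullTriangulations {δ ε : ℕ} {B : Finset (ℕ × ℕ)} :
    B ∈ fullTriangulations δ ε ↔ IsTriangulation δ ε B ∧ IsBlack B δ ε := by
  simp only [fullTriangulations, Finset.mem_filter, mem_triangulations]

theorem IsTriangulation.eq_empty {δ ε : ℕ} {B : Finset (ℕ × ℕ)} (hB : IsTriangulation δ ε B)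
    (h : ε ≤ δ + 1) : B = ∅ := by
  rw [Finset.eq_empty_iff_forall_notMem]
  intro p hp
  have := hB.colouring p hp
  omega

/-- Cut at the far end of the longest arc, or base edge, starting at δ: the left part has a black
vertex and the right part is arbitrary. -/
theorem card_triangulations_succ (δ n : ℕ) :
    (triangulations δ (δ + n + 1)).card = ∑ i ∈ Finset.range (n + 1),
      (fullTriangulations δ (δ + i + 1)).card * (triangulations (δ + i + 1) (δ + n + 1)).card := by
  simp_rw [← Finset.card_product]
  rw [← Finset.card_sigma]
  symm
  refine Finset.card_bij (fun x _ => ∅ ∪ (x.2.1 ∪ x.2.2)) ?_ ?_ ?_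
  · rintro ⟨i, B₁, B₂⟩ h
    simp only [Finset.mem_sigma, Finset.mem_range, Finset.mem_product, mem_fullTriangulations,
      mem_triangulations] at h ⊢
    rw [Finset.empty_union]
    exact h.2.1.1.glue h.2.2 (by omega) (by omega)
  · rintro ⟨i, B₁, B₂⟩ h ⟨i', B₁', B₂'⟩ h' heq
    simp only [Finset.mem_sigma, Finset.mem_range, Finset.mem_product, mem_fullTriangulations,
      mem_triangulations] at h h' heq
    have c1 := glue_cut_le (by omega) h.2.1.1.colouring h.2.2.colouring h'.2.1.2 (by simp) heq
    have c2 := glue_cut_le (by omega) h'.2.1.1.colouring h'.2.2.colouring h.2.1.2 (by simp) heq.symm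
    obtain rfl : i = i' := by omega
    have e1 := glue_left_eq (T := ∅) h.2.1.1.colouring h.2.2.colouring (by simp)
    have e2 := glue_right_eq (T := ∅) (by omega) h.2.1.1.colouring h.2.2.colouring (by simp)
    rw [heq, glue_left_eq (T := ∅) h'.2.1.1.colouring h'.2.2.colouring (by simp)] at e1
    rw [heq, glue_right_eq (T := ∅) (by omega) h'.2.1.1.colouring h'.2.2.colouring (by simp)] at e2
    rw [e1, e2]
  · intro B hB
    rw [mem_triangulations] at hB
    classical
    obtain ⟨z, hz, hmax⟩ := Finset.exists_max_image
      ((Finset.Ioc δ (δ + n + 1)).filter fun z => IsBlack B δ z) id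
      ⟨δ + 1, by
        simp only [Finset.mem_filter, Finset.mem_Ioc]
        exact ⟨by omega, Or.inl rfl⟩⟩
    simp only [Finset.mem_filter, Finset.mem_Ioc, id] at hz hmax
    obtain ⟨i, rfl⟩ : ∃ i, z = δ + i + 1 := ⟨z - δ - 1, by omega⟩
    refine ⟨⟨i, B.filter fun p => δ ≤ p.1 ∧ p.2 ≤ δ + i + 1,
      B.filter fun p => δ + i + 1 ≤ p.1 ∧ p.2 ≤ δ + n + 1⟩, ?_, ?_⟩
    · simp only [Finset.mem_sigma, Finset.mem_range, Finset.mem_product, mem_fullTriangulations,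
        mem_triangulations]
      exact ⟨by omega, ⟨hB.restrict _ _, hz.2.imp id fun h => Finset.mem_filter.2
        ⟨h, le_rfl, le_rfl⟩⟩, hB.restrict _ _⟩
    · simp only [Finset.empty_union]
      refine eq_union_filter ?_
      rintro ⟨x, y⟩ hp
      have b := hB.colouring _ hp
      refine ⟨b.1, b.2.2, ?_⟩
      simp only at b ⊢
      by_contra! hc
      rcases b.1.eq_or_lt with rfl | hx
      · have := hmax y ⟨by omega, Or.inr hp⟩
        omega
      · rcases hz.2 with hz' | hz'
        · omega
        · exact hB.noncrossing _ _ _ _ hz' hp hx hc.2 hc.1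

/-- Segner's recursion: remove the outermost arc and cut at the third vertex of the triangle below
it. -/
theorem card_fullTriangulations_succ (δ n : ℕ) :
    (fullTriangulations δ (δ + n + 2)).card = ∑ i ∈ Finset.range (n + 1),
      (fullTriangulations δ (δ + i + 1)).card *
        (fullTriangulations (δ + i + 1) (δ + n + 2)).card := by
  simp_rw [← Finset.card_product]
  rw [← Finset.card_sigma]
  symm
  have hT : ∀ i, i < n + 1 → ∀ p ∈ ({(δ, δ + n + 2)} : Finset (ℕ × ℕ)), p.1 = δ ∧ δ + i + 1 < p.2 := by
    intro i hi p hp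
    rw [Finset.mem_singleton] at hp
    subst hp
    exact ⟨rfl, by simp only; omega⟩
  refine Finset.card_bij (fun x _ => {(δ, δ + n + 2)} ∪ (x.2.1 ∪ x.2.2)) ?_ ?_ ?_
  · rintro ⟨i, B₁, B₂⟩ h
    simp only [Finset.mem_sigma, Finset.mem_range, Finset.mem_product, mem_fullTriangulations] at h ⊢
    rw [← Finset.insert_eq]
    refine ⟨(h.2.1.1.glue h.2.2.1 (by omega) (by omega)).insert_vertex (z := δ + i + 1)
      (by omega) (by omega) (h.2.1.2.imp id (Finset.mem_union_left _))
      (h.2.2.2.imp id (Finset.mem_union_right _)), Or.inr (Finset.mem_insert_self _ _)⟩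
  · rintro ⟨i, B₁, B₂⟩ h ⟨i', B₁', B₂'⟩ h' heq
    simp only [Finset.mem_sigma, Finset.mem_range, Finset.mem_product,
      mem_fullTriangulations] at h h' heq
    have c1 := glue_cut_le (by omega) h.2.1.1.colouring h.2.2.1.colouring h'.2.1.2 (hT _ h'.1) heq
    have c2 := glue_cut_le (by omega) h'.2.1.1.colouring h'.2.2.1.colouring h.2.1.2 (hT _ h.1)
      heq.symm
    obtain rfl : i = i' := by omega
    have e1 := glue_left_eq h.2.1.1.colouring h.2.2.1.colouring (hT i h.1)
    have e2 := glue_right_eq (by omega) h.2.1.1.colouring h.2.2.1.colouring (hT i h.1)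
    rw [heq, glue_left_eq h'.2.1.1.colouring h'.2.2.1.colouring (hT i h.1)] at e1
    rw [heq, glue_right_eq (by omega) h'.2.1.1.colouring h'.2.2.1.colouring (hT i h.1)] at e2
    rw [e1, e2]
  · intro B hB
    rw [mem_fullTriangulations] at hB
    obtain ⟨hB, hb⟩ := hB
    have hv : (δ, δ + n + 2) ∈ B := hb.resolve_left (by omega)
    obtain ⟨z, h1, h2, h3, h4⟩ := hB.split _ _ hv
    obtain ⟨i, rfl⟩ : ∃ i, z = δ + i + 1 := ⟨z - δ - 1, by omega⟩
    refine ⟨⟨i, B.filter fun p => δ ≤ p.1 ∧ p.2 ≤ δ + i + 1,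
      B.filter fun p => δ + i + 1 ≤ p.1 ∧ p.2 ≤ δ + n + 2⟩, ?_, ?_⟩
    · simp only [Finset.mem_sigma, Finset.mem_range, Finset.mem_product, mem_fullTriangulations]
      exact ⟨by omega, ⟨hB.restrict _ _, h3.imp id fun h => Finset.mem_filter.2
        ⟨h, le_rfl, le_rfl⟩⟩, hB.restrict _ _, h4.imp id fun h => Finset.mem_filter.2
        ⟨h, le_rfl, le_rfl⟩⟩
    · ext ⟨x, y⟩
      simp only [Finset.mem_union, Finset.mem_singleton, Finset.mem_filter, Prod.mk.injEq]
      constructor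
      · rintro (⟨rfl, rfl⟩ | h | h)
        · exact hv
        · exact h.1
        · exact h.1
      · intro hp
        have b := hB.colouring _ hp
        simp only at b
        by_contra! hc
        obtain ⟨c1, c2, c3⟩ := hc
        have d2 := c2 hp b.1
        rcases b.1.eq_or_lt with rfl | hx
        · have hy := c1 rfl
          rcases h4 with h4 | h4
          · omega
          · exact hB.noncrossing _ _ _ _ hp h4 h1 d2 (by omega)
        · have hx' : x < δ + i + 1 := by
            by_contra hge
            have := c3 hp (by omega)
            omega
          rcases h3 with h3 | h3
          · omega
          · exact hB.noncrossing _ _ _ _ h3 hp hx hx' d2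

theorem card_fullTriangulations (n : ℕ) : ∀ δ,
    (fullTriangulations δ (δ + n + 1)).card = catalan n := by
  induction n using Nat.strong_induction_on with
  | _ n ih =>
    intro δ
    rcases n with _ | n
    · rw [catalan_zero, Finset.card_eq_one]
      refine ⟨∅, ?_⟩
      ext B
      rw [mem_fullTriangulations, Finset.mem_singleton]
      exact ⟨fun h => h.1.eq_empty (by omega),
        fun h => h ▸ ⟨isTriangulation_empty _ _, Or.inl rfl⟩⟩
    · rw [← add_assoc, card_fullTriangulations_succ, catalan_succ',
        Finset.Nat.sum_antidiagonal_eq_sum_range_succ_mk]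
      refine Finset.sum_congr rfl fun i hi => ?_
      rw [Finset.mem_range] at hi
      rw [ih i hi, ← ih (n - i) (by omega) (δ + i + 1)]
      congr 3
      omega

theorem card_triangulations (n : ℕ) : ∀ δ, (triangulations δ (δ + n)).card = catalan n := by
  induction n using Nat.strong_induction_on with
  | _ n ih =>
    intro δ
    rcases n with _ | n
    · rw [catalan_zero, Finset.card_eq_one]
      refine ⟨∅, ?_⟩
      ext B
      rw [mem_triangulations, Finset.mem_singleton]
      exact ⟨fun h => h.eq_empty (by omega), fun h => h ▸ isTriangulation_empty _ _⟩
    · rw [← add_assoc, card_triangulations_succ, catalan_succ',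
        Finset.Nat.sum_antidiagonal_eq_sum_range_succ_mk]
      refine Finset.sum_congr rfl fun i hi => ?_
      rw [Finset.mem_range] at hi
      rw [card_fullTriangulations, ← ih (n - i) (by omega) (δ + i + 1)]
      congr 3
      omega

theorem ncard_isSparse {δ ε : ℕ} (h : δ ≤ ε) : {B | IsSparse δ ε B}.ncard = catalan (ε - δ) := by
  obtain ⟨n, rfl⟩ := Nat.exists_eq_add_of_le h
  rw [Nat.add_sub_cancel_left, ← card_triangulations n δ, ← Set.ncard_coe_finset]
  congr 1
  ext B
  rw [Set.mem_ofPred_eq, isSparse_iff, Finset.mem_coe, mem_triangulations]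

end CyclicQuotient

namespace CyclicQuotient

/-! ## The minimal primes of `J'` -/

section Components

variable {e : ℕ} {a : ℕ → ℕ} {B : Finset (ℕ × ℕ)}

theorem mk_sigma_diag {I : Ideal (BaseRing e a)} {ε : ℕ} (h : tPar e a ε ∈ I) (i j : ℕ) :
    Ideal.Quotient.mk I (sigma e a ε i j) = Ideal.Quotient.mk I (sigma e a ε (i + j) 0) := by
  have ht : Ideal.Quotient.mk I (-tPar e a ε) = Ideal.Quotient.mk I 0 := by
    rw [map_neg, Ideal.Quotient.eq_zero_iff_mem.2 h, neg_zero, map_zero]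
  rw [sigma_eq, sigma_eq, map_iterRem, map_iterRem, ht, iterRem_diag]

/-- Below an arc t lies in the ideal, so a remainder modulo the ideal depends only on i + j, and the
indices can be moved into the range listed among the generators. -/
theorem sigma_mem_of_admissible (he : 4 ≤ e) (hB : IsTriangulation 2 (e - 1) B) {ε : ℕ}
    (h2 : 2 ≤ ε) (hε : ε < e) {i j : ℕ} (h : Admissible 2 (e - 1) B ε i j) :
    sigma e a ε i j ∈ componentIdeal e a B := by
  obtain ⟨_, h3, _⟩ := exp_facts (a := a) he hB h2 hε
  rcases h with ⟨hab, hi, hj⟩ | ⟨hab, hij⟩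
  · rw [theta_of_not_above hab] at h3
    exact sigma_mem_componentIdeal he hB h2 hε hi hj (by omega)
  · rw [theta_of_above hab] at h3
    have ht := tPar_mem_componentIdeal (a := a) hB hab
    have hm := sigma_mem_componentIdeal (a := a) he hB h2 hε
      (i := min (i + j) (rightCount 2 (e - 1) B ε))
      (j := i + j - min (i + j) (rightCount 2 (e - 1) B ε)) (by omega) (by omega) (by omega)
    rw [← Ideal.Quotient.eq_zero_iff_mem, mk_sigma_diag ht] at hm ⊢
    rw [← hm]
    congr 2
    omega

theorem JPrime_le_componentIdeal (he : 4 ≤ e) (hB : IsTriangulation 2 (e - 1) B) :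
    JPrime e a ≤ componentIdeal e a B := by
  unfold JPrime
  rw [Ideal.span_le]
  rintro f ((⟨ε, h2, hε, rfl⟩ | ⟨δ, η, B', h2, h3, hη, hB', rfl⟩) | ⟨δ, η, B', h2, h3, hη, hB', rfl⟩)
  · by_cases hab : Above B ε
    · refine Ideal.mul_mem_right _ _ ?_
      simpa [lPar, rPar] using tPar_mem_componentIdeal (a := a) hB hab
    · refine Ideal.mul_mem_left _ _ (sigma_mem_of_admissible he hB h2.le (by omega)
        (Or.inl ⟨hab, one_le_rightCount h2.le (by omega), one_le_leftCount h2 (by omega)⟩))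
  · obtain ⟨β, h4, h5, h6⟩ := exists_admissible (p := 1) (q := 0) η hB (isSparse_iff.1 hB') le_rfl
      h2 h3 (by omega) (by omega)
    rw [one_mul, zero_mul, add_zero] at h6
    exact Ideal.mem_of_dvd _ (Finset.dvd_prod_of_mem _ (Finset.mem_Icc.2 ⟨h4, h5⟩))
      (sigma_mem_of_admissible he hB (by omega) (by omega) h6)
  · obtain ⟨β, h4, h5, h6⟩ := exists_admissible (p := 0) (q := 1) η hB (isSparse_iff.1 hB') le_rfl
      h2.le h3 (by omega) (by omega)
    rw [one_mul, zero_mul, add_zero] at h6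
    exact Ideal.mem_of_dvd _ (Finset.dvd_prod_of_mem _ (Finset.mem_Icc.2 ⟨h4, h5⟩))
      (sigma_mem_of_admissible he hB (by omega) (by omega) h6)

theorem tPar_mul_sigma_mem (ε : ℕ) : tPar e a ε * sigma e a ε 1 1 ∈ JPrime e a := by
  by_cases h : 2 < ε ∧ ε + 1 < e
  · exact Ideal.subset_span (Or.inl (Or.inl ⟨ε, h.1, h.2, by simp [lPar, rPar]⟩))
  · rw [tPar_eq_zero e a h, zero_mul]
    exact zero_mem _

theorem vanishingSystem_quotient {Q : Ideal (BaseRing e a)} (hQ : JPrime e a ≤ Q) :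
    VanishingSystem 2 (e - 1) (fun β i j => Ideal.Quotient.mk Q (sigma e a β i j))
      (fun β => Ideal.Quotient.mk Q (tPar e a β)) := by
  refine ⟨?_, ?_, ?_, ?_, ?_, ?_, ?_⟩
  · rw [tPar_eq_zero e a (by omega), map_zero]
  · rw [tPar_eq_zero e a (by omega), map_zero]
  · intro β _ _ i j
    rw [← map_sub, sigma_sub, map_mul]
  · intro β _ _
    rw [sigma_one_zero]
    exact Ideal.Quotient.eq_zero_iff_mem.2 (hQ (tPar_mul_sigma_mem β))
  · intro β _ _
    rw [sigma_zero_one, map_zero]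
  · intro δ η B hB h1 h2 h3
    rw [← map_prod]
    exact Ideal.Quotient.eq_zero_iff_mem.2 (hQ (Ideal.subset_span
      (Or.inl (Or.inr ⟨δ, η, B, h1, h2, by omega, isSparse_iff.2 hB, rfl⟩))))
  · intro δ η B hB h1 h2 h3
    rw [← map_prod]
    exact Ideal.Quotient.eq_zero_iff_mem.2 (hQ (Ideal.subset_span
      (Or.inr ⟨δ, η, B, h1, h2, by omega, isSparse_iff.2 hB, rfl⟩)))

theorem exists_componentIdeal_le (he : 4 ≤ e) {Q : Ideal (BaseRing e a)} [Q.IsPrime]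
    (hQ : JPrime e a ≤ Q) : ∃ B, IsTriangulation 2 (e - 1) B ∧ componentIdeal e a B ≤ Q := by
  obtain ⟨B, hB, hL⟩ := VanishingSystem.exists_lies _ (vanishingSystem_quotient hQ) le_rfl
  refine ⟨B, hB, ?_⟩
  unfold componentIdeal
  rw [Ideal.span_le]
  rintro f (⟨ε, h2, hε, hab, rfl⟩ | ⟨ε, i, j, h2, hε, h0, hij, hi, hj, rfl⟩)
  · exact Ideal.Quotient.eq_zero_iff_mem.1
      ((hL ε h2 (by omega)).1 (one_lt_alphaNum_iff.1 hab))
  · obtain ⟨h3, h4, _⟩ := exp_facts (a := a) he hB h2 hε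
    exact Ideal.Quotient.eq_zero_iff_mem.1 ((hL ε h2 (by omega)).2 i j hi hj h0 (by omega))

/-- Test elements of P_B on the parametrisation of B'. The t's show that a vertex below an arc of B
is below one of B'. The remainders of total index k + 1, with k taken from B', show that at vertices
below arcs of B' the degree in B is no larger. -/
theorem eq_of_componentIdeal_le (he : 4 ≤ e) {B' : Finset (ℕ × ℕ)}
    (hB : IsTriangulation 2 (e - 1) B) (hB' : IsTriangulation 2 (e - 1) B')
    (hk : ∀ ε, 2 ≤ ε → ε < e → leftExp e B' ε + rightExp e B' ε ≤ a ε)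
    (h : componentIdeal e a B ≤ componentIdeal e a B') : B = B' := by
  have hker := componentIdeal_le_ker he hB' hk
  refine hB.eq_of_counts_le _ hB' le_rfl ?_ ?_
  · intro β hab
    have b := hB.above_bounds hab
    by_contra hab'
    have h1 := hker (h (tPar_mem_componentIdeal hB hab))
    rw [RingHom.mem_ker, paramMap_tPar, tComp_of_not_above hab', tPar, dif_pos (by omega)] at h1
    exact MvPolynomial.X_ne_zero _ h1
  · intro β hab
    have b := hB'.above_bounds hab
    by_contra! hlt
    obtain ⟨_, h3, _⟩ := exp_facts (a := a) he hB b.1.le (by omega)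
    obtain ⟨_, h3', _⟩ := exp_facts (a := a) he hB' b.1.le (by omega)
    rw [theta_of_above hab] at h3'
    have hθ := theta_le_one B β
    have hm := sigma_mem_componentIdeal (a := a) he hB b.1.le (by omega)
      (i := min (leftExp e B' β + rightExp e B' β + 1) (rightCount 2 (e - 1) B β))
      (j := leftExp e B' β + rightExp e B' β + 1 -
        min (leftExp e B' β + rightExp e B' β + 1) (rightCount 2 (e - 1) B β))
      (by omega) (by omega) (by omega)
    exact paramMap_sigma_ne_zero he hB' b.1.le (by omega) (hk β b.1.le (by omega)) hab (by omega)
      (hker (h hm))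

/-- The P_B are primes over J', every prime over J' contains one of them, and none contains another;
hence they are exactly the minimal primes. -/
theorem bijOn_componentIdeal (he : 4 ≤ e)
    (hk : ∀ B, IsTriangulation 2 (e - 1) B → ∀ ε, 2 ≤ ε → ε < e →
      leftExp e B ε + rightExp e B ε ≤ a ε) :
    Set.BijOn (componentIdeal e a) {B | IsSparse 2 (e - 1) B} (JPrime e a).minimalPrimes := by
  refine ⟨?_, ?_, ?_⟩
  · intro B hB
    replace hB := isSparse_iff.1 hB
    refine ⟨⟨componentIdeal_isPrime he hB (hk B hB), JPrime_le_componentIdeal he hB⟩, ?_⟩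
    rintro Q ⟨hQ, hJ⟩ hQB
    obtain ⟨B', hB', hQ'⟩ := exists_componentIdeal_le he hJ
    rw [← eq_of_componentIdeal_le he hB' hB (hk B hB) (hQ'.trans hQB)]
    exact hQ'
  · intro B hB B' hB' h
    replace hB := isSparse_iff.1 hB
    replace hB' := isSparse_iff.1 hB'
    exact eq_of_componentIdeal_le he hB hB' (hk B' hB') h.le
  · rintro Q ⟨⟨hQ, hJ⟩, hmin⟩
    obtain ⟨B, hB, hQ'⟩ := exists_componentIdeal_le he hJ
    exact ⟨B, isSparse_iff.2 hB, le_antisymm hQ'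
      (hmin ⟨componentIdeal_isPrime he hB (hk B hB), JPrime_le_componentIdeal he hB⟩ hQ')⟩

theorem componentIdeal_empty (e : ℕ) (a : ℕ → ℕ) (he : 4 ≤ e) :
    componentIdeal e a ∅ = artinIdeal e a := by
  have hE := isTriangulation_empty 2 (e - 1)
  refine le_antisymm ?_ ?_
  · unfold componentIdeal
    rw [Ideal.span_le]
    rintro f (⟨ε, h2, hε, hab, rfl⟩ | ⟨ε, i, j, h2, hε, h0, _, hi, hj, rfl⟩)
    · exact absurd (one_lt_alphaNum_iff.1 hab) (not_above_empty _)
    · have hi1 : i ≤ 1 ∧ (ε = e - 1 → i = 0) := by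
        rcases (by omega : ε = e - 1 ∨ ε < e - 1) with rfl | h
        · rw [rightCount_last hE.colouring] at hi; omega
        · rw [rightCount_empty h2 h] at hi; omega
      have hj1 : j ≤ 1 ∧ (ε = 2 → j = 0) := by
        rcases h2.eq_or_lt with rfl | h2
        · rw [leftCount_first hE.colouring] at hj; omega
        · rw [leftCount_empty h2 (by omega)] at hj; omega
      obtain ⟨rfl, rfl⟩ | ⟨rfl, rfl⟩ | ⟨rfl, rfl⟩ :
        (i = 1 ∧ j = 0) ∨ (i = 0 ∧ j = 1) ∨ (i = 1 ∧ j = 1) := by omega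
      · rw [sigma_one_zero]
        by_cases h : 2 < ε ∧ ε + 1 < e
        · exact Ideal.mul_mem_left _ _ (Ideal.subset_span ⟨ε, h.1, h.2, rfl⟩)
        · rw [tPar_eq_zero e a h, zero_mul]
          exact zero_mem _
      · rw [sigma_zero_one]
        exact zero_mem _
      · exact Ideal.subset_span ⟨ε, by omega, by omega, rfl⟩
  · unfold artinIdeal
    rw [Ideal.span_le]
    rintro f ⟨ε, h2, hε, rfl⟩
    exact sigma_mem_of_admissible he hE h2.le (by omega) (Or.inl ⟨not_above_empty _,
      one_le_rightCount h2.le (by omega), one_le_leftCount h2 (by omega)⟩)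

/-- The function `σ_ε^{(11)}` vanishes on a component unless the triangle has an ear at `ε`. -/
theorem sigma_one_one_mem_iff (he : 4 ≤ e) (hB : IsTriangulation 2 (e - 1) B)
    (hk : ∀ ε, 2 ≤ ε → ε < e → leftExp e B ε + rightExp e B ε ≤ a ε) {c : ℕ} (h2 : 2 ≤ c)
    (hc : c + 2 < e) : sigma e a (c + 1) 1 1 ∈ componentIdeal e a B ↔ (c, c + 2) ∉ B := by
  have hR : 1 ≤ rightCount 2 (e - 1) B (c + 1) := one_le_rightCount (by omega) (by omega)
  have hL : 1 ≤ leftCount 2 (e - 1) B (c + 1) := one_le_leftCount (by omega) (by omega)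
  constructor
  · intro h hear
    obtain ⟨N, hN⟩ : ∃ N, e - 1 = N + 1 := ⟨e - 2, by omega⟩
    have hcount : rightCount 2 (e - 1) B (c + 1) = 1 ∧ leftCount 2 (e - 1) B (c + 1) = 1 := by
      rw [hN] at hB ⊢
      exact counts_of_ear hB hear
    have hab := above_of_ear hear
    obtain ⟨_, h3, _⟩ := exp_facts (a := a) he hB (by omega : 2 ≤ c + 1) (by omega)
    rw [theta_of_above hab] at h3
    exact paramMap_sigma_ne_zero he hB (by omega) (by omega) (hk _ (by omega) (by omega)) hab
      (by omega) (componentIdeal_le_ker he hB hk h)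
  · intro hear
    refine sigma_mem_of_admissible he hB (by omega) (by omega) ?_
    by_cases hab : Above B (c + 1)
    · refine Or.inr ⟨hab, ?_⟩
      by_contra hlt
      exact hear (hB.ear_of_counts hab (by omega) (by omega))
    · exact Or.inl ⟨hab, hR, hL⟩

theorem isTriangulation_blowUp_interior {B : Finset (ℕ × ℕ)} {c : ℕ} (h2 : 2 ≤ c) (hc : c + 2 < e)
    (hB : IsTriangulation 2 (e - 2) B) :
    IsTriangulation 2 (e - 1) (blowUp 2 (e - 2) (c + 1) B) ∧
      (c, c + 2) ∈ blowUp 2 (e - 2) (c + 1) B := by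
  refine ⟨?_, (mem_blowUp hB.colouring).2 (Or.inr ⟨h2, by omega, rfl, rfl⟩)⟩
  have := isTriangulation_blowUp hB c
  rwa [blowLeft_of_le h2, blowRight_of_le (by omega), show e - 2 + 1 = e - 1 by omega] at this

theorem exists_blowDown_interior {B : Finset (ℕ × ℕ)} {c : ℕ} (hB : IsTriangulation 2 (e - 1) B)
    (hear : (c, c + 2) ∈ B) :
    ∃ B', IsTriangulation 2 (e - 2) B' ∧ blowUp 2 (e - 2) (c + 1) B' = B := by
  have b := hB.colouring _ hear
  simp only at b
  refine IsTriangulation.exists_blowDown ?_ hear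
  rwa [show e - 2 + 1 = e - 1 by omega]

end Components

end CyclicQuotient

/-! ### The proposition -/

open CyclicQuotient

theorem mainTheorem6 (e : ℕ) (he : 4 ≤ e) (a : ℕ → ℕ)
    (ha : ∀ ε, 2 ≤ ε → ε < e → 2 ≤ a ε)
    (hk : ∀ B, CyclicQuotient.IsSparse 2 (e - 1) B →
      ∀ ε, 2 ≤ ε → ε < e → CyclicQuotient.kNum 2 (e - 1) B ε ≤ a ε) :
    (CyclicQuotient.JPrime e a).minimalPrimes.ncard = catalan (e - 3) ∧
    Set.BijOn (CyclicQuotient.componentIdeal e a)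
      {B | CyclicQuotient.IsSparse 2 (e - 1) B} (CyclicQuotient.JPrime e a).minimalPrimes ∧
    CyclicQuotient.componentIdeal e a ∅ = CyclicQuotient.artinIdeal e a ∧
    CyclicQuotient.artinIdeal e a ∈ (CyclicQuotient.JPrime e a).minimalPrimes ∧
    (∀ ε, 2 < ε → ε + 1 < e →
      (∀ B, CyclicQuotient.IsSparse 2 (e - 2) B →
        CyclicQuotient.IsSparse 2 (e - 1) (CyclicQuotient.blowUp 2 (e - 2) ε B)) ∧
      {P ∈ (CyclicQuotient.JPrime e a).minimalPrimes | CyclicQuotient.sigma e a ε 1 1 ∉ P} =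
        {P | ∃ B, CyclicQuotient.IsSparse 2 (e - 2) B ∧
          P = CyclicQuotient.componentIdeal e a (CyclicQuotient.blowUp 2 (e - 2) ε B)}) ∧
    (∀ P ∈ (CyclicQuotient.JPrime e a).minimalPrimes, P ≠ CyclicQuotient.artinIdeal e a →
      ∃ ε B, 2 < ε ∧ ε + 1 < e ∧ CyclicQuotient.IsSparse 2 (e - 2) B ∧
        P = CyclicQuotient.componentIdeal e a (CyclicQuotient.blowUp 2 (e - 2) ε B)) := by
  have hk' : ∀ B, IsTriangulation 2 (e - 1) B → ∀ ε, 2 ≤ ε → ε < e →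
      leftExp e B ε + rightExp e B ε ≤ a ε := by
    intro B hB ε h2 hε
    rw [(exp_facts (a := a) he hB h2 hε).1]
    exact hk B (isSparse_iff.2 hB) ε h2 hε
  have hbij := bijOn_componentIdeal he hk'
  have hA := componentIdeal_empty e a he
  refine ⟨?_, hbij, hA, ?_, ?_, ?_⟩
  · rw [← hbij.image_eq, hbij.injOn.ncard_image, ncard_isSparse (by omega)]
    congr 1
  · rw [← hA]
    exact hbij.mapsTo (isSparse_iff.2 (isTriangulation_empty _ _))
  · intro ε h2 hε
    obtain ⟨c, rfl⟩ : ∃ c, ε = c + 1 := ⟨ε - 1, by omega⟩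
    have hblow : ∀ B, IsSparse 2 (e - 2) B → IsTriangulation 2 (e - 1) (blowUp 2 (e - 2) (c + 1) B) ∧
        (c, c + 2) ∈ blowUp 2 (e - 2) (c + 1) B :=
      fun B hB => isTriangulation_blowUp_interior (by omega) (by omega) (isSparse_iff.1 hB)
    refine ⟨fun B hB => isSparse_iff.2 (hblow B hB).1, ?_⟩
    ext P
    constructor
    · rintro ⟨hP, hσ⟩
      obtain ⟨B, hB, rfl⟩ := hbij.surjOn hP
      replace hB := isSparse_iff.1 hB
      rw [sigma_one_one_mem_iff he hB (hk' B hB) (by omega) (by omega), not_not] at hσ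
      obtain ⟨B', hB', rfl⟩ := exists_blowDown_interior hB hσ
      exact ⟨B', isSparse_iff.2 hB', rfl⟩
    · rintro ⟨B, hB, rfl⟩
      obtain ⟨h3, h4⟩ := hblow B hB
      refine ⟨hbij.mapsTo (isSparse_iff.2 h3), ?_⟩
      rw [sigma_one_one_mem_iff he h3 (hk' _ h3) (by omega) (by omega), not_not]
      exact h4
  · intro P hP hne
    obtain ⟨B, hB, rfl⟩ := hbij.surjOn hP
    replace hB := isSparse_iff.1 hB
    -- A triangle other than the empty one has an ear, and it is the blow-up at the tip of that ear.
    obtain ⟨c, hc⟩ := hB.exists_ear (by rintro rfl; exact hne hA)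
    have b := hB.colouring _ hc
    simp only at b
    obtain ⟨B', hB', rfl⟩ := exists_blowDown_interior hB hc
    exact ⟨c + 1, B', by omega, by omega, isSparse_iff.2 hB', rfl⟩
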